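/- Let $d_1\ge 0$ and let $V_d=\langle v_0,\dots,v_d\rangle$ denote the irreducible complex $\mathfrak{sl}_2$-module of dimension $d+1$, on which the raising and lowering elements of $\mathfrak{sl}_2$ act by $D_1(v_i)=i\,v_{i-1}$ and $D_2(v_i)=(d-i)\,v_{i+1}$. Extend $D_1,D_2$ to derivations of the symmetric algebra $S(V_{d_1}\oplus V_{d_2})$, let $$\mathcal I_{d_1,d_2}=S(V_{d_1}\oplus V_{d_2})^{\mathfrak{sl}_2}=\{p : D_1(p)=0,\ D_2(p)=0\}$$ be the algebra of joint invariants of two binary forms of degrees $d_1,d_2$, and let $\mathcal{PI}_{d_1,d_2}(z)=\sum_{n\ge 0}\dim\big((\mathcal I_{d_1,d_2})_n\big)z^n$ be its Poincaré series. Put $$f_{d_1,d_2}(t,z)=\frac{1}{\prod_{i=0}^{d_1}(1-tz^{d_1-2i})\,\prod_{j=0}^{d_2}(1-tz^{d_2-2j})},$$ and for $m,n\ge 0$ put $\Psi_{m,n}\big(\sum_{i,j\ge0} a_{i,j}t^iz^j\big)=\sum_{i\ge0} a_{im,in}z^i$ on $\mathbb C[[t,z]]$ and $\varphi_n\big(\sum_{i\ge0}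 a_iz^i\big)=\sum_{i\ge0} a_{in}z^i$ on $\mathbb C[[z]]$; for $n<0$ put $\varphi_n=0$. **Theorem 4.** Let $d_2>d_1$ and $d_2\equiv d_1\pmod 2$. Then, with $f_{d_1,d_2}(tz^{d_2},z)$ expanded in $\mathbb C[[t,z]]$, $$\mathcal{PI}_{d_1,d_2}(z)=\Psi_{1,d_2}\big((1-z^2)f_{d_1,d_2}(tz^{d_2},z)\big).$$ Moreover, for all complex $z$ with $0<|z|<1$ the limits $$A_k(z)=-\frac{1}{z^{d_2+d_1-2k}}\lim_{t\to z^{2k-(d_1+d_2)}}\frac{\partial}{\partial t}\Big(f_{d_1,d_2}(tz^{d_2},z)(1-tz^{d_2+d_1-2k})^2\Big),$$ $$B_k(z)=\lim_{t\to z^{2k-(d_1+d_2)}}\Big(f_{d_1,d_2}(tz^{d_2},z)(1-tz^{d_2+d_1-2k})^2\Big)\qquad(0\le k\le d_1),$$ $$C_k(z)=\lim_{t\to z^{-2k}}\Big(f_{d_1,d_2}(tz^{d_2},z)(1-tz^{2k})\Big)\qquad(0\le 2k\le d_2-d_1-2\ \text{ or }\ d_1+d_2+2\le 2k\le 2d_2)$$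 exist and are the sums of convergent power series in $z$ (again denoted $A_k,B_k,C_k$); these are the coefficients of the partial fraction decomposition $$f_{d_1,d_2}(tz^{d_2},z)=\sum_{k=0}^{d_1}\Big(\frac{A_k(z)}{1-tz^{d_2+d_1-2k}}+\frac{B_k(z)}{(1-tz^{d_2+d_1-2k})^2}\Big)+\sum_{0\le 2k\le d_2-d_1-2}\frac{C_k(z)}{1-tz^{2k}}+\sum_{d_1+d_2+2\le 2k\le 2d_2}\frac{C_k(z)}{1-tz^{2k}},$$ and $$\mathcal{PI}_{d_1,d_2}(z)=\sum_{d_1/2\le k\le d_1}\varphi_{2k-d_1}\big((1-z^2)A_k(z)\big)+\sum_{d_1/2\le k\le d_1}\Big(z\,\varphi_{2k-d_1}\big((1-z^2)B_k(z)\big)\Big)'+\sum_{0\le 2k\le d_2-d_1-2}\varphi_{d_2-2k}\big((1-z^2)C_k(z)\big)+\sum_{d_1+d_2+2\le 2k\le 2d_2}\varphi_{d_2-2k}\big((1-z^2)C_k(z)\big).$$ -/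

import Mathlib

open Filter Topology
open scoped PowerSeries

noncomputable section

namespace JointForms

/-- Index set of the basis `v₀, …, v_{d₁}, w₀, …, w_{d₂}` of `V_{d₁} ⊕ V_{d₂}`. -/
abbrev Idx (d₁ d₂ : ℕ) : Type := Fin (d₁ + 1) ⊕ Fin (d₂ + 1)

/-- The symmetric algebra `S(V_{d₁} ⊕ V_{d₂})`, written as the polynomial algebra in the
basis vectors. -/
abbrev Sym (d₁ d₂ : ℕ) : Type := MvPolynomial (Idx d₁ d₂) ℂ

/-- The basis vector `v i` of `V_{d₁}` in `S(V_{d₁} ⊕ V_{d₂})` (zero for `i > d₁`). -/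
def v (d₁ d₂ i : ℕ) : Sym d₁ d₂ :=
  if h : i < d₁ + 1 then MvPolynomial.X (Sum.inl ⟨i, h⟩) else 0

/-- The basis vector `w i` of `V_{d₂}` in `S(V_{d₁} ⊕ V_{d₂})` (zero for `i > d₂`). -/
def w (d₁ d₂ i : ℕ) : Sym d₁ d₂ :=
  if h : i < d₂ + 1 then MvPolynomial.X (Sum.inr ⟨i, h⟩) else 0

/-- The action of the raising element of `sl₂`: the derivation with `D₁(vᵢ) = i vᵢ₋₁` on the basis
of either summand. -/
def D1 (d₁ d₂ : ℕ) : Derivation ℂ (Sym d₁ d₂) (Sym d₁ d₂) :=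
  MvPolynomial.mkDerivation ℂ (Sum.elim
    (fun i => ((i : ℕ) : ℂ) • v d₁ d₂ ((i : ℕ) - 1))
    (fun i => ((i : ℕ) : ℂ) • w d₁ d₂ ((i : ℕ) - 1)))

/-- The action of the lowering element of `sl₂`: the derivation with `D₂(vᵢ) = (d - i) vᵢ₊₁` on the
basis of either summand. -/
def D2 (d₁ d₂ : ℕ) : Derivation ℂ (Sym d₁ d₂) (Sym d₁ d₂) :=
  MvPolynomial.mkDerivation ℂ (Sum.elim
    (fun i => ((d₁ : ℂ) - ((i : ℕ) : ℂ)) • v d₁ d₂ ((i : ℕ) + 1))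
    (fun i => ((d₂ : ℂ) - ((i : ℕ) : ℂ)) • w d₁ d₂ ((i : ℕ) + 1)))

/-- The algebra of joint invariants `S(V_{d₁} ⊕ V_{d₂})^{sl₂}`. -/
def jointInvariants (d₁ d₂ : ℕ) : Subalgebra ℂ (Sym d₁ d₂) where
  carrier := {p | D1 d₁ d₂ p = 0 ∧ D2 d₁ d₂ p = 0}
  mul_mem' := by
    rintro a b ⟨ha, ha'⟩ ⟨hb, hb'⟩
    simp [Derivation.leibniz, ha, ha', hb, hb']
  add_mem' := by
    rintro a b ⟨ha, ha'⟩ ⟨hb, hb'⟩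
    simp [ha, ha', hb, hb']
  algebraMap_mem' := by
    intro r
    simp

/-- The homogeneous component of degree `n` of the algebra of joint invariants. -/
def jointInvariantsDeg (d₁ d₂ n : ℕ) : Submodule ℂ (Sym d₁ d₂) :=
  Subalgebra.toSubmodule (jointInvariants d₁ d₂) ⊓
    MvPolynomial.homogeneousSubmodule (Idx d₁ d₂) ℂ n

/-- The Poincaré series of the algebra of joint invariants, as an element of `ℂ[[z]]`. -/
def PI (d₁ d₂ : ℕ) : ℂ⟦X⟧ :=
  PowerSeries.mk fun n => (Module.finrank ℂ (jointInvariantsDeg d₁ d₂ n) : ℂ)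

/-- The variable `z`, in `ℂ[[z]]`. -/
def z : ℂ⟦X⟧ := PowerSeries.X

/-- The variable `t`, in `ℂ[[t, z]] = ℂ[[z]][[t]]`. -/
def t : ℂ⟦X⟧⟦X⟧ := PowerSeries.X

/-- The inclusion `ℂ[[z]] ⊆ ℂ[[t, z]]`. -/
def incl : ℂ⟦X⟧ →+* ℂ⟦X⟧⟦X⟧ := PowerSeries.C

/-- `Ψ_{m,n}(∑ a_{i,j} tⁱ zʲ) = ∑ a_{im,in} zⁱ`. -/
def Psi (m n : ℕ) : ℂ⟦X⟧⟦X⟧ →ₗ[ℂ] ℂ⟦X⟧ where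
  toFun F := PowerSeries.mk fun i => PowerSeries.coeff (i * n) (PowerSeries.coeff (i * m) F)
  map_add' F G := by
    ext i
    simp
  map_smul' c F := by
    ext i
    simp

/-- `φ_n(∑ aᵢ zⁱ) = ∑ a_{in} zⁱ` for `n ≥ 0`, and `φ_n = 0` for `n < 0`. -/
def phi (n : ℤ) (R : ℂ⟦X⟧) : ℂ⟦X⟧ :=
  if n < 0 then 0 else PowerSeries.mk fun i => PowerSeries.coeff (i * n.toNat) R

/-- The expansion of `1 / (1 - t z^a)` in `ℂ[[t, z]]`. -/
def geom (a : ℕ) : ℂ⟦X⟧⟦X⟧ :=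
  PowerSeries.invOfUnit (1 - t * incl (z ^ a)) 1

/-- The expansion of `f_{d₁,d₂}(t z^{d₂}, z)` in `ℂ[[t, z]]`, for `d₁ ≤ d₂`: after replacing `t` by
`t z^{d₂}`, the exponents of `z` in the factors are `d₂ + d₁ - 2i` and `d₂ + d₂ - 2j`. -/
def fSeries (d₁ d₂ : ℕ) : ℂ⟦X⟧⟦X⟧ :=
  (∏ i ∈ Finset.range (d₁ + 1), geom (d₂ + d₁ - 2 * i)) *
    ∏ j ∈ Finset.range (d₂ + 1), geom (d₂ + d₂ - 2 * j)

/-- The rational function `f_{d₁,d₂}(t, z)`, at complex numbers `t` and `z`. -/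
def f (d₁ d₂ : ℕ) (t z : ℂ) : ℂ :=
  1 / ((∏ i ∈ Finset.range (d₁ + 1), (1 - t * z ^ ((d₁ : ℤ) - 2 * (i : ℤ)))) *
    ∏ j ∈ Finset.range (d₂ + 1), (1 - t * z ^ ((d₂ : ℤ) - 2 * (j : ℤ))))

/-- The power series `R` is the expansion of the function `z ↦ lim_{t → z^{-a}} G(t, z)`: for
`0 < |z| < 1` the limit exists, and `R` converges at `z` to it. Such an `R` is unique. -/
def IsLimitExpansion (R : ℂ⟦X⟧) (a : ℕ) (G : ℂ → ℂ → ℂ) : Prop :=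
  ∀ z : ℂ, 0 < ‖z‖ → ‖z‖ < 1 → ∃ L : ℂ,
    Tendsto (fun t => G t z) (𝓝[≠] (z ^ (-(a : ℤ)))) (𝓝 L) ∧
      HasSum (fun n : ℕ => PowerSeries.coeff n R * z ^ n) L

/-- `A(z) = -z^{-a} lim_{t → z^{-a}} (f_{d₁,d₂}(t z^{d₂}, z) (1 - t z^a)²)'_t`. -/
def IsCoeffA (d₁ d₂ a : ℕ) (A : ℂ⟦X⟧) : Prop :=
  IsLimitExpansion A a fun t z =>
    -(1 / z ^ a) * deriv (fun s => f d₁ d₂ (s * z ^ d₂) z * (1 - s * z ^ a) ^ 2) t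

/-- `B(z) = lim_{t → z^{-a}} f_{d₁,d₂}(t z^{d₂}, z) (1 - t z^a)²`. -/
def IsCoeffB (d₁ d₂ a : ℕ) (B : ℂ⟦X⟧) : Prop :=
  IsLimitExpansion B a fun t z => f d₁ d₂ (t * z ^ d₂) z * (1 - t * z ^ a) ^ 2

/-- `C(z) = lim_{t → z^{-a}} f_{d₁,d₂}(t z^{d₂}, z) (1 - t z^a)`. -/
def IsCoeffC (d₁ d₂ a : ℕ) (C : ℂ⟦X⟧) : Prop :=
  IsLimitExpansion C a fun t z => f d₁ d₂ (t * z ^ d₂) z * (1 - t * z ^ a)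

/-- The values of `k` that index simple poles: `2k ≤ d₂ - d₁ - 2`. -/
def lowSimple (d₁ d₂ : ℕ) : Finset ℕ :=
  (Finset.range (d₂ + 1)).filter fun k => 2 * (k : ℤ) ≤ (d₂ : ℤ) - d₁ - 2

/-- The values of `k` that index simple poles: `d₁ + d₂ + 2 ≤ 2k ≤ 2 d₂`. -/
def highSimple (d₁ d₂ : ℕ) : Finset ℕ :=
  (Finset.range (d₂ + 1)).filter fun k => d₁ + d₂ + 2 ≤ 2 * k

end JointForms

end

open JointForms

/-!
# The Poincaré series of the joint invariants of two binary forms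

Let `S_n` be the `n`-th symmetric power of `V_{d₁} ⊕ V_{d₂}`. A form in `S_n` is invariant iff it has
weight `0` and is killed by `D₂`, and `D₂` maps the weight space `0` of `S_n` *onto* the weight space
`-2`: if `p` has weight `-2` and `D₂ D₁ p = 0`, then `D₁ D₂ᵏ⁺¹ p = -(k + 1) (k + 2) D₂ᵏ p` for all
`k`, and since `D₂` is nilpotent on `S_n` this forces `p = 0`; so `D₂ D₁` is bijective on the weight
space `-2` (`eq_zero_of_weight_neg_two`). Hence `dim (I_n)` is the difference of the
dimensions of two weight spaces (`finrank_jointInvariantsDeg_add`). These count monomials, and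
their generating function is `f_{d₁,d₂}(t z^{d₂}, z)`, which gives `PI = Ψ((1 - z²) f)`
(`PI_eq_Psi`).

For the partial fractions write `d₂ = d₁ + 2 e`, so that all poles are at `t = 1 / y_a` with
`y_a = z^{2a}`, for `0 ≤ a ≤ d₂`, and those with `e ≤ a ≤ e + d₁` are double. The functions
`g_a = 1 / (1 - t y_a)` satisfy `g_a g_b = c_{ab} g_a + c_{ba} g_b` with `c_{ab} = y_a / (y_a - y_b)`.
For fixed `d` the quotients `c_{d a}` are the values of the `g_a` at `t = 1 / y_d`, so they satisfy the
same relation; this makes the expansion of a product of distinct `g_a` provable by induction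
(`prod_eq_sum_simpleCoeff`), and the double poles come from multiplying two such expansions
(`prod_mul_prod_eq_sum`). The argument is valid in any domain: applied in `ℂ[[z]][[t]]` it gives
the formal decomposition, applied in `ℂ` the decomposition at a fixed `z` with `0 < |z| < 1`. The
coefficients are the same polynomial expressions in the `c_{ab}`, each of which is a power series
convergent in the unit disc; the limits are then read off from the numerical decomposition.

Finally `Ψ` sends `R / (1 - t z^a)` to `φ_{d₂-a}(R)` and `R / (1 - t z^a)²` to `(z φ_{d₂-a}(R))'`,
provided that `R(0) = 0` if `a > d₂`; this holds since the coefficients at the poles with `a > 0`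
are divisible by a positive power of `z`.
-/

noncomputable section

namespace JointForms

/-! ### Partial fractions with simple and double poles -/

section PartialFractions

variable {S : Type*} [CommRing S]

/-- The coefficient of `1 / (1 - t yₐ)` in `∏_{b ∈ s} 1 / (1 - t y_b)`, in terms of the quotients
`c a b = yₐ / (yₐ - y_b)`. -/
def simpleCoeff (c : ℕ → ℕ → S) (s : Finset ℕ) (a : ℕ) : S :=
  ∏ b ∈ s.erase a, c a b

/-- The coefficient of `1 / (1 - t yₐ)` in
`(∏_{b ∈ s} 1 / (1 - t y_b)) * ∏_{b ∈ D} 1 / (1 - t y_b)`. -/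
def fracCoeff (c : ℕ → ℕ → S) (s D : Finset ℕ) (a : ℕ) : S :=
  (if a ∈ s then simpleCoeff c s a * ∑ b ∈ D.erase a, simpleCoeff c D b * c a b else 0) +
    if a ∈ D then simpleCoeff c D a * ∑ b ∈ s.erase a, simpleCoeff c s b * c a b else 0

/-- The coefficient of `1 / (1 - t yₐ)²` in
`(∏_{b ∈ s} 1 / (1 - t y_b)) * ∏_{b ∈ D} 1 / (1 - t y_b)`, for `a ∈ s ∩ D`. -/
def sqCoeff (c : ℕ → ℕ → S) (s D : Finset ℕ) (a : ℕ) : S :=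
  simpleCoeff c s a * simpleCoeff c D a

/-- The three-term relation `c d a * c d b = c a b * c d a + c b a * c d b` says that `g = c d`
satisfies the relation required of `g`; the induction hypothesis for `c d` gives the coefficient
of the new term `g d`. -/
theorem prod_eq_sum_simpleCoeff (c : ℕ → ℕ → S)
    (hc : ∀ d a b, a ≠ b → a ≠ d → b ≠ d → c d a * c d b = c a b * c d a + c b a * c d b)
    (s : Finset ℕ) (hs : s.Nonempty) (g : ℕ → S)
    (hg : ∀ a ∈ s, ∀ b ∈ s, a ≠ b → g a * g b = c a b * g a + c b a * g b) :
    ∏ a ∈ s, g a = ∑ a ∈ s, simpleCoeff c s a * g a := by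
  induction hs using Finset.Nonempty.cons_induction generalizing g with
  | singleton a => simp [simpleCoeff]
  | cons d s hd hs ih =>
    have hne : ∀ a ∈ s, a ≠ d := fun a ha h => hd (h ▸ ha)
    rw [Finset.prod_cons, Finset.sum_cons,
      ih g fun a ha b hb => hg a (Finset.mem_cons_of_mem ha) b (Finset.mem_cons_of_mem hb)]
    have h1 : simpleCoeff c (Finset.cons d s hd) d = ∑ a ∈ s, simpleCoeff c s a * c d a := by
      rw [← ih (c d) fun a ha b hb hab => hc d a b hab (hne a ha) (hne b hb)]
      simp [simpleCoeff, Finset.erase_eq_of_notMem hd]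
    have h2 : ∀ a ∈ s, simpleCoeff c (Finset.cons d s hd) a = simpleCoeff c s a * c a d := by
      intro a ha
      rw [simpleCoeff, Finset.cons_eq_insert, Finset.erase_insert_of_ne (hne a ha).symm,
        Finset.prod_insert (fun h => hd (Finset.mem_of_mem_erase h)), simpleCoeff, mul_comm]
    rw [h1, Finset.mul_sum, Finset.sum_mul, ← Finset.sum_add_distrib]
    refine Finset.sum_congr rfl fun a ha => ?_
    rw [h2 a ha]
    linear_combination simpleCoeff c s a *
      hg a (Finset.mem_cons_of_mem ha) d (Finset.mem_cons_self d s) (hne a ha)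

/-- Multiply the two expansions of `prod_eq_sum_simpleCoeff` and split the mixed products. -/
theorem prod_mul_prod_eq_sum (c : ℕ → ℕ → S)
    (hc : ∀ d a b, a ≠ b → a ≠ d → b ≠ d → c d a * c d b = c a b * c d a + c b a * c d b)
    (s D : Finset ℕ) (hD : D.Nonempty) (hDs : D ⊆ s) (g : ℕ → S)
    (hg : ∀ a ∈ s, ∀ b ∈ s, a ≠ b → g a * g b = c a b * g a + c b a * g b) :
    (∏ a ∈ s, g a) * ∏ a ∈ D, g a =
      ∑ a ∈ s, fracCoeff c s D a * g a + ∑ a ∈ D, sqCoeff c s D a * g a ^ 2 := by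
  rw [prod_eq_sum_simpleCoeff c hc s (hD.mono hDs) g hg,
    prod_eq_sum_simpleCoeff c hc D hD g fun a ha b hb => hg a (hDs ha) b (hDs hb),
    Finset.sum_mul_sum]
  have hterm : ∀ a ∈ s, ∀ b ∈ D,
      simpleCoeff c s a * g a * (simpleCoeff c D b * g b) =
        (if a = b then sqCoeff c s D b * g b ^ 2 else 0) +
        ((if a ≠ b then simpleCoeff c s a * (simpleCoeff c D b * c a b) * g a else 0) +
        if a ≠ b then simpleCoeff c D b * (simpleCoeff c s a * c b a) * g b else 0) := by
    intro a ha b hb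
    by_cases h : a = b
    · subst h
      simp [sqCoeff]
      ring
    · simp only [h, if_false, ne_eq, not_false_eq_true, if_true]
      linear_combination simpleCoeff c s a * simpleCoeff c D b * hg a ha b (hDs hb) h
  rw [Finset.sum_congr rfl fun a ha => Finset.sum_congr rfl fun b hb => hterm a ha b hb]
  simp only [Finset.sum_add_distrib]
  have e1 : ∑ a ∈ s, ∑ b ∈ D, (if a = b then sqCoeff c s D b * g b ^ 2 else 0) =
      ∑ a ∈ D, sqCoeff c s D a * g a ^ 2 := by
    rw [Finset.sum_comm]
    refine Finset.sum_congr rfl fun b hb => ?_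
    rw [Finset.sum_ite_eq' s b, if_pos (hDs hb)]
  have e2 : ∀ a ∈ s, ∑ b ∈ D,
      (if a ≠ b then simpleCoeff c s a * (simpleCoeff c D b * c a b) * g a else 0) =
      (simpleCoeff c s a * ∑ b ∈ D.erase a, simpleCoeff c D b * c a b) * g a := by
    intro a _
    rw [← Finset.sum_filter, Finset.filter_ne, Finset.mul_sum, Finset.sum_mul]
  have e3 : ∀ b ∈ D, ∑ a ∈ s,
      (if a ≠ b then simpleCoeff c D b * (simpleCoeff c s a * c b a) * g b else 0) =
      (simpleCoeff c D b * ∑ a ∈ s.erase b, simpleCoeff c s a * c b a) * g b := by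
    intro b _
    rw [← Finset.sum_filter, Finset.filter_ne', Finset.mul_sum, Finset.sum_mul]
  rw [e1, Finset.sum_congr rfl e2, add_comm]
  congr 1
  rw [Finset.sum_comm, Finset.sum_congr rfl e3]
  simp only [fracCoeff, add_mul, Finset.sum_add_distrib, ite_mul, zero_mul]
  congr 1
  · exact Finset.sum_congr rfl fun a ha => by rw [if_pos ha]
  · rw [← Finset.sum_filter, Finset.filter_mem_eq_inter, Finset.inter_eq_right.2 hDs]

/-- The partial fraction decomposition of `(∏_{a ∈ s} 1 / (1 - t yₐ)) * ∏_{a ∈ D} 1 / (1 - t yₐ)`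
in a domain, where `c a b = yₐ / (yₐ - y_b)` and `g a = 1 / (1 - t yₐ)`. -/
theorem partialFractions [IsDomain S] (y : ℕ → S) (hy : Function.Injective y) (c : ℕ → ℕ → S)
    (hc : ∀ a b, a ≠ b → c a b * (y a - y b) = y a) (s D : Finset ℕ) (hD : D.Nonempty)
    (hDs : D ⊆ s) (t : S) (g : ℕ → S) (hg : ∀ a ∈ s, (1 - t * y a) * g a = 1) :
    (∏ a ∈ s, g a) * ∏ a ∈ D, g a =
      ∑ a ∈ s, fracCoeff c s D a * g a + ∑ a ∈ D, sqCoeff c s D a * g a ^ 2 := by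
  have hsub : ∀ a b, a ≠ b → y a - y b ≠ 0 := fun a b h => sub_ne_zero.2 (hy.ne h)
  have hsum : ∀ a b, a ≠ b → c a b + c b a = 1 := by
    intro a b h
    apply mul_right_cancel₀ (hsub a b h)
    linear_combination hc a b h - hc b a h.symm
  refine prod_mul_prod_eq_sum c ?_ s D hD hDs g ?_
  · intro d a b hab had hbd
    apply mul_right_cancel₀ (hsub d a had.symm)
    apply mul_right_cancel₀ (hsub d b hbd.symm)
    have h1 := hc d a had.symm
    have h2 := hc d b hbd.symm
    have h3 := hc a b hab
    have h4 := hsum a b hab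
    linear_combination (c d b * (y d - y b) - c a b * (y d - y b)) * h1 +
      (y d - c b a * (y d - y a)) * h2 - y d * h3 - y d * (y d - y a) * h4
  · intro a ha b hb hab
    have h1 := hg a ha
    have h2 := hg b hb
    have h3 := hc a b hab
    have h4 := hsum a b hab
    linear_combination c a b * g a * h2 + c b a * g b * h1 +
      g a * g b * ((t * y a - 1) * h4 - t * h3)

end PartialFractions

/-! ### Limits at the poles of a sum of partial fractions -/

section Limits

variable {s : Finset ℕ} {y : ℕ → ℂ} {α β : ℕ → ℂ} {F : ℂ → ℂ} {a : ℕ}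

/-- Near the pole `1 / yₐ`, a sum of partial fractions is its polar part there plus an analytic
function. -/
theorem exists_polar_part (hy : Function.Injective y) (hy0 : ∀ a, y a ≠ 0)
    (hF : ∀ t, (∀ b ∈ s, 1 - t * y b ≠ 0) →
      F t = ∑ b ∈ s, (α b * (1 - t * y b)⁻¹ + β b * (1 - t * y b)⁻¹ ^ 2))
    (ha : a ∈ s) :
    ∃ h : ℂ → ℂ, AnalyticAt ℂ h (y a)⁻¹ ∧ ∀ᶠ t in 𝓝[≠] (y a)⁻¹, 1 - t * y a ≠ 0 ∧
      F t = α a * (1 - t * y a)⁻¹ + β a * (1 - t * y a)⁻¹ ^ 2 + h t := by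
  have hlin : ∀ b, AnalyticAt ℂ (fun t : ℂ => 1 - t * y b) (y a)⁻¹ := fun b => by fun_prop
  have hne : ∀ b ∈ s.erase a, 1 - (y a)⁻¹ * y b ≠ 0 := by
    intro b hb h
    refine Finset.ne_of_mem_erase hb (hy ?_)
    have := hy0 a
    field_simp at h
    linear_combination -h
  refine ⟨fun t => ∑ b ∈ s.erase a, (α b * (1 - t * y b)⁻¹ + β b * (1 - t * y b)⁻¹ ^ 2), ?_, ?_⟩
  · refine Finset.analyticAt_fun_sum _ fun b hb => ?_
    have h1 := (hlin b).inv (hne b hb)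
    exact (analyticAt_const.mul h1).add (analyticAt_const.mul (h1.pow 2))
  · have h1 : ∀ᶠ t in 𝓝[≠] (y a)⁻¹, 1 - t * y a ≠ 0 := by
      filter_upwards [self_mem_nhdsWithin] with t ht h
      refine ht ?_
      have := hy0 a
      rw [Set.mem_singleton_iff]
      field_simp
      linear_combination -h
    have h2 : ∀ᶠ t in 𝓝[≠] (y a)⁻¹, ∀ b ∈ s.erase a, 1 - t * y b ≠ 0 := by
      refine eventually_nhdsWithin_of_eventually_nhds ?_
      rw [Filter.eventually_all_finset]
      exact fun b hb => (hlin b).continuousAt.eventually_ne (hne b hb)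
    filter_upwards [h1, h2] with t ht1 ht2
    refine ⟨ht1, ?_⟩
    rw [hF t, ← Finset.add_sum_erase _ _ ha]
    intro b hb
    by_cases hba : b = a
    · rwa [hba]
    · exact ht2 b (Finset.mem_erase.2 ⟨hba, hb⟩)

theorem tendsto_simple_pole (hy : Function.Injective y) (hy0 : ∀ a, y a ≠ 0)
    (hF : ∀ t, (∀ b ∈ s, 1 - t * y b ≠ 0) →
      F t = ∑ b ∈ s, (α b * (1 - t * y b)⁻¹ + β b * (1 - t * y b)⁻¹ ^ 2))
    (ha : a ∈ s) (hβ : β a = 0) :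
    Tendsto (fun t => F t * (1 - t * y a)) (𝓝[≠] (y a)⁻¹) (𝓝 (α a)) := by
  obtain ⟨h, hh, hev⟩ := exists_polar_part hy hy0 hF ha
  have hcont : ContinuousAt (fun t => α a + h t * (1 - t * y a)) (y a)⁻¹ :=
    continuousAt_const.add (hh.continuousAt.mul (by fun_prop))
  have hlim := hcont.tendsto.mono_left (nhdsWithin_le_nhds (s := {(y a)⁻¹}ᶜ))
  simp only [inv_mul_cancel₀ (hy0 a), sub_self, mul_zero, add_zero] at hlim
  refine hlim.congr' ?_
  filter_upwards [hev] with t ht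
  rw [ht.2, hβ]
  have := ht.1
  field_simp
  ring

/-- Near the pole, `F t * (1 - t yₐ)²` agrees off the pole with an analytic function whose value
and derivative there are `β a` and `-yₐ α a`. -/
theorem exists_analytic_double_pole (hy : Function.Injective y) (hy0 : ∀ a, y a ≠ 0)
    (hF : ∀ t, (∀ b ∈ s, 1 - t * y b ≠ 0) →
      F t = ∑ b ∈ s, (α b * (1 - t * y b)⁻¹ + β b * (1 - t * y b)⁻¹ ^ 2))
    (ha : a ∈ s) :
    ∃ Φ : ℂ → ℂ, AnalyticAt ℂ Φ (y a)⁻¹ ∧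
      (∀ᶠ t in 𝓝[≠] (y a)⁻¹, Φ t = F t * (1 - t * y a) ^ 2) ∧
      Φ (y a)⁻¹ = β a ∧ deriv Φ (y a)⁻¹ = -(y a * α a) := by
  obtain ⟨h, hh, hev⟩ := exists_polar_part hy hy0 hF ha
  have hlin : AnalyticAt ℂ (fun t : ℂ => 1 - t * y a) (y a)⁻¹ := by fun_prop
  have hu : 1 - (y a)⁻¹ * y a = 0 := by rw [inv_mul_cancel₀ (hy0 a), sub_self]
  refine ⟨fun t => β a + α a * (1 - t * y a) + h t * (1 - t * y a) ^ 2,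
    (analyticAt_const.add (analyticAt_const.mul hlin)).add (hh.mul (hlin.pow 2)), ?_, ?_, ?_⟩
  · filter_upwards [hev] with t ht
    rw [ht.2]
    have := ht.1
    field_simp
    ring
  · simp [hu]
  · have d1 : HasDerivAt (fun t : ℂ => 1 - t * y a) (-y a) (y a)⁻¹ := by
      simpa using ((hasDerivAt_id (y a)⁻¹).mul_const (y a)).const_sub 1
    have d2 := hh.differentiableAt.hasDerivAt
    have d3 := ((d1.const_mul (α a)).const_add (β a)).add (d2.mul (d1.pow 2))
    have := d3.deriv
    simp only [hu] at this
    refine Eq.trans ?_ (this.trans ?_)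
    · rfl
    · simp [hu]; ring

theorem tendsto_double_pole (hy : Function.Injective y) (hy0 : ∀ a, y a ≠ 0)
    (hF : ∀ t, (∀ b ∈ s, 1 - t * y b ≠ 0) →
      F t = ∑ b ∈ s, (α b * (1 - t * y b)⁻¹ + β b * (1 - t * y b)⁻¹ ^ 2))
    (ha : a ∈ s) :
    Tendsto (fun t => F t * (1 - t * y a) ^ 2) (𝓝[≠] (y a)⁻¹) (𝓝 (β a)) := by
  obtain ⟨Φ, hΦ, hev, h0, -⟩ := exists_analytic_double_pole hy hy0 hF ha
  rw [← h0]
  exact (hΦ.continuousAt.tendsto.mono_left nhdsWithin_le_nhds).congr' hev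

theorem tendsto_deriv_double_pole (hy : Function.Injective y) (hy0 : ∀ a, y a ≠ 0)
    (hF : ∀ t, (∀ b ∈ s, 1 - t * y b ≠ 0) →
      F t = ∑ b ∈ s, (α b * (1 - t * y b)⁻¹ + β b * (1 - t * y b)⁻¹ ^ 2))
    (ha : a ∈ s) :
    Tendsto (fun t => -(1 / y a) * deriv (fun t => F t * (1 - t * y a) ^ 2) t)
      (𝓝[≠] (y a)⁻¹) (𝓝 (α a)) := by
  obtain ⟨Φ, hΦ, hev, -, h1⟩ := exists_analytic_double_pole hy hy0 hF ha
  have hα : α a = -(1 / y a) * deriv Φ (y a)⁻¹ := by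
    have := hy0 a
    rw [h1]
    field_simp
  rw [hα]
  refine Tendsto.const_mul _
    ((hΦ.deriv.continuousAt.tendsto.mono_left nhdsWithin_le_nhds).congr' ?_)
  -- An equality that holds near a point of an open punctured neighbourhood passes to derivatives.
  have hev' := eventually_eventually_nhdsWithin.2 hev
  filter_upwards [hev', self_mem_nhdsWithin] with t ht htne
  rw [isOpen_compl_singleton.nhdsWithin_eq htne] at ht
  exact Filter.EventuallyEq.deriv_eq ht

end Limits

/-! ### Evaluation of power series inside the unit disc -/

/-- The power series `R` converges absolutely at `z`, with sum `x`. -/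
def ConvergesTo (R : ℂ⟦X⟧) (z x : ℂ) : Prop :=
  Summable (fun n => ‖PowerSeries.coeff n R * z ^ n‖) ∧
    HasSum (fun n => PowerSeries.coeff n R * z ^ n) x

namespace ConvergesTo

variable {R Q : ℂ⟦X⟧} {z x x' : ℂ}

theorem add (h : ConvergesTo R z x) (h' : ConvergesTo Q z x') :
    ConvergesTo (R + Q) z (x + x') := by
  refine ⟨?_, ?_⟩
  · refine (h.1.add h'.1).of_nonneg_of_le (fun _ => norm_nonneg _) fun n => ?_
    rw [map_add, add_mul]
    exact norm_add_le _ _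
  · simpa only [map_add, add_mul] using h.2.add h'.2

theorem mul (h : ConvergesTo R z x) (h' : ConvergesTo Q z x') :
    ConvergesTo (R * Q) z (x * x') := by
  have key : ∀ n, PowerSeries.coeff n (R * Q) * z ^ n = ∑ kl ∈ Finset.HasAntidiagonal.antidiagonal n,
      PowerSeries.coeff kl.1 R * z ^ kl.1 * (PowerSeries.coeff kl.2 Q * z ^ kl.2) := by
    intro n
    rw [PowerSeries.coeff_mul, Finset.sum_mul]
    refine Finset.sum_congr rfl fun kl hkl => ?_
    rw [← Finset.HasAntidiagonal.mem_antidiagonal.1 hkl, pow_add]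
    ring
  have hs := summable_norm_sum_mul_antidiagonal_of_summable_norm h.1 h'.1
  have ht := tsum_mul_tsum_eq_tsum_sum_antidiagonal_of_summable_norm h.1 h'.1
  simp only [← key] at hs ht
  rw [h.2.tsum_eq, h'.2.tsum_eq] at ht
  exact ⟨hs, ht ▸ hs.of_norm.hasSum⟩

theorem monomial (n : ℕ) (c z : ℂ) : ConvergesTo (PowerSeries.monomial n c) z (c * z ^ n) := by
  have h0 : ∀ m ∉ ({n} : Finset ℕ), PowerSeries.coeff m (PowerSeries.monomial n c) * z ^ m = 0 := by
    intro m hm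
    rw [PowerSeries.coeff_monomial, if_neg (by simpa using hm), zero_mul]
  refine ⟨summable_of_ne_finset_zero (s := {n}) fun m hm => by rw [h0 m hm, norm_zero], ?_⟩
  simpa using hasSum_sum_of_ne_finset_zero h0

theorem zero (z : ℂ) : ConvergesTo 0 z 0 := by
  simpa using monomial 0 0 z

theorem one (z : ℂ) : ConvergesTo 1 z 1 := by
  simpa using monomial 0 1 z

theorem X_pow (n : ℕ) (z : ℂ) : ConvergesTo (PowerSeries.X ^ n) z (z ^ n) := by
  simpa [PowerSeries.X_pow_eq] using monomial n 1 z

theorem neg (h : ConvergesTo R z x) : ConvergesTo (-R) z (-x) := by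
  simpa [ConvergesTo] using And.intro h.1 h.2.neg

theorem unique (h : ConvergesTo R z x) (h' : ConvergesTo R z x') : x = x' :=
  h.2.unique h'.2

theorem sum {s : Finset ℕ} {R : ℕ → ℂ⟦X⟧} {x : ℕ → ℂ}
    (h : ∀ a ∈ s, ConvergesTo (R a) z (x a)) :
    ConvergesTo (∑ a ∈ s, R a) z (∑ a ∈ s, x a) := by
  induction s using Finset.cons_induction with
  | empty => exact zero z
  | cons a s ha ih =>
    rw [Finset.sum_cons, Finset.sum_cons]
    exact (h a (Finset.mem_cons_self a s)).add
      (ih fun b hb => h b (Finset.mem_cons_of_mem hb))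

theorem prod {s : Finset ℕ} {R : ℕ → ℂ⟦X⟧} {x : ℕ → ℂ}
    (h : ∀ a ∈ s, ConvergesTo (R a) z (x a)) :
    ConvergesTo (∏ a ∈ s, R a) z (∏ a ∈ s, x a) := by
  induction s using Finset.cons_induction with
  | empty => exact one z
  | cons a s ha ih =>
    rw [Finset.prod_cons, Finset.prod_cons]
    exact (h a (Finset.mem_cons_self a s)).mul
      (ih fun b hb => h b (Finset.mem_cons_of_mem hb))

end ConvergesTo

/-- The expansion of `1 / (1 - z ^ n)` in `ℂ[[z]]`. -/
def invOneSubXPow (n : ℕ) : ℂ⟦X⟧ :=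
  PowerSeries.mk fun i => if n ∣ i then 1 else 0

theorem one_sub_X_pow_mul_inv {n : ℕ} (hn : 0 < n) :
    (1 - PowerSeries.X ^ n) * invOneSubXPow n = 1 := by
  ext i
  rw [sub_mul, one_mul, map_sub, PowerSeries.coeff_X_pow_mul', invOneSubXPow,
    PowerSeries.coeff_mk, PowerSeries.coeff_one]
  rcases Nat.lt_or_ge i n with h | h
  · rw [if_neg (by omega : ¬n ≤ i), sub_zero]
    refine if_congr ⟨fun hd => ?_, fun hd => hd ▸ dvd_zero n⟩ rfl rfl
    exact Nat.eq_zero_of_dvd_of_lt hd h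
  · have hd : n ∣ i - n ↔ n ∣ i := (Nat.dvd_sub_iff_left h (dvd_refl n))
    rw [if_pos h, PowerSeries.coeff_mk, if_neg (by omega : i ≠ 0), if_congr hd rfl rfl, sub_self]

theorem convergesTo_invOneSubXPow {n : ℕ} (hn : 0 < n) {z : ℂ} (hz : ‖z‖ < 1) :
    ConvergesTo (invOneSubXPow n) z (1 - z ^ n)⁻¹ := by
  have hs : Summable fun i => ‖PowerSeries.coeff i (invOneSubXPow n) * z ^ i‖ := by
    refine (summable_geometric_of_lt_one (norm_nonneg z) hz).of_nonneg_of_le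
      (fun _ => norm_nonneg _) fun i => ?_
    rw [invOneSubXPow, PowerSeries.coeff_mk, norm_mul, norm_pow]
    refine mul_le_of_le_one_left (by positivity) ?_
    split_ifs <;> simp
  have h : ConvergesTo (invOneSubXPow n) z _ := ⟨hs, hs.of_norm.hasSum⟩
  have h1 := ((ConvergesTo.one z).add (ConvergesTo.X_pow n z).neg).mul h
  rw [← sub_eq_add_neg, one_sub_X_pow_mul_inv hn, ← sub_eq_add_neg] at h1
  rwa [eq_inv_of_mul_eq_one_right ((ConvergesTo.one z).unique h1).symm] at h

/-- The expansion of `z ^ (2 * a) / (z ^ (2 * a) - z ^ (2 * b))` in `ℂ[[z]]`, for `a ≠ b`. -/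
def ratio (a b : ℕ) : ℂ⟦X⟧ :=
  if a < b then invOneSubXPow (2 * (b - a))
  else -(PowerSeries.X ^ (2 * (a - b)) * invOneSubXPow (2 * (a - b)))

theorem ratio_mul {a b : ℕ} (h : a ≠ b) :
    ratio a b * (z ^ (2 * a) - z ^ (2 * b)) = z ^ (2 * a) := by
  rcases Nat.lt_or_gt_of_ne h with h | h
  · obtain ⟨k, rfl⟩ := Nat.exists_eq_add_of_lt h
    have h1 := one_sub_X_pow_mul_inv (n := 2 * (a + k + 1 - a)) (by omega)
    rw [ratio, if_pos h, z, show 2 * (a + k + 1) = 2 * a + 2 * (a + k + 1 - a) by omega, pow_add]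
    linear_combination PowerSeries.X ^ (2 * a) * h1
  · obtain ⟨k, rfl⟩ := Nat.exists_eq_add_of_lt h
    have h1 := one_sub_X_pow_mul_inv (n := 2 * (b + k + 1 - b)) (by omega)
    rw [ratio, if_neg (by omega), z,
      show 2 * (b + k + 1) = 2 * b + 2 * (b + k + 1 - b) by omega, pow_add]
    have h2 : 2 * b + 2 * (b + k + 1 - b) = 2 * (b + k + 1) := by omega
    linear_combination
      PowerSeries.X ^ (2 * b) * PowerSeries.X ^ (2 * (b + k + 1 - b)) * h1

theorem pow_two_mul_injective {z : ℂ} (h0 : 0 < ‖z‖) (h1 : ‖z‖ < 1) :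
    Function.Injective fun a : ℕ => z ^ (2 * a) := by
  intro a b h
  have h' : ‖z‖ ^ (2 * a) = ‖z‖ ^ (2 * b) := by
    rw [← norm_pow, ← norm_pow]
    exact congrArg norm h
  have := pow_right_injective₀ h0 h1.ne h'
  omega

theorem convergesTo_ratio {a b : ℕ} (h : a ≠ b) {z : ℂ} (h0 : 0 < ‖z‖) (h1 : ‖z‖ < 1) :
    ConvergesTo (ratio a b) z (z ^ (2 * a) / (z ^ (2 * a) - z ^ (2 * b))) := by
  obtain ⟨x, hx⟩ : ∃ x, ConvergesTo (ratio a b) z x := by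
    unfold ratio
    split_ifs with hab
    · exact ⟨_, convergesTo_invOneSubXPow (by omega) h1⟩
    · exact ⟨_, ((ConvergesTo.X_pow _ z).mul (convergesTo_invOneSubXPow (by omega) h1)).neg⟩
  have h2 := hx.mul ((ConvergesTo.X_pow (2 * a) z).add (ConvergesTo.X_pow (2 * b) z).neg)
  rw [← sub_eq_add_neg, ← sub_eq_add_neg, show (PowerSeries.X : ℂ⟦X⟧) = JointForms.z from rfl,
    ratio_mul h] at h2
  have h3 := h2.unique (ConvergesTo.X_pow (2 * a) z)
  have hne : z ^ (2 * a) - z ^ (2 * b) ≠ 0 := sub_ne_zero.2 ((pow_two_mul_injective h0 h1).ne h)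
  rwa [eq_div_of_mul_eq hne h3] at hx

theorem constantCoeff_ratio_of_lt {a b : ℕ} (h : b < a) :
    PowerSeries.constantCoeff (ratio a b) = 0 := by
  rw [ratio, if_neg (by omega), map_neg, map_mul, map_pow, PowerSeries.constantCoeff_X,
    zero_pow (by omega), zero_mul, neg_zero]

section Coefficients

variable {s D : Finset ℕ} {a : ℕ} {z : ℂ} {c : ℕ → ℕ → ℂ⟦X⟧} {x : ℕ → ℕ → ℂ}

theorem ConvergesTo.simpleCoeff (h : ∀ a b, a ≠ b → ConvergesTo (c a b) z (x a b))
    (s : Finset ℕ) (a : ℕ) : ConvergesTo (simpleCoeff c s a) z (simpleCoeff x s a) :=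
  ConvergesTo.prod fun _ hb => h a _ (Finset.ne_of_mem_erase hb).symm

theorem ConvergesTo.sqCoeff (h : ∀ a b, a ≠ b → ConvergesTo (c a b) z (x a b))
    (s D : Finset ℕ) (a : ℕ) : ConvergesTo (sqCoeff c s D a) z (sqCoeff x s D a) :=
  (ConvergesTo.simpleCoeff h s a).mul (ConvergesTo.simpleCoeff h D a)

theorem ConvergesTo.fracCoeff (h : ∀ a b, a ≠ b → ConvergesTo (c a b) z (x a b))
    (s D : Finset ℕ) (a : ℕ) : ConvergesTo (fracCoeff c s D a) z (fracCoeff x s D a) := by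
  have key : ∀ s D : Finset ℕ, ∀ P : Prop, ∀ [Decidable P], ConvergesTo
      (if P then JointForms.simpleCoeff c s a *
        ∑ b ∈ D.erase a, JointForms.simpleCoeff c D b * c a b else 0) z
      (if P then JointForms.simpleCoeff x s a *
        ∑ b ∈ D.erase a, JointForms.simpleCoeff x D b * x a b else 0) := by
    intro s D P _
    split_ifs
    · exact (ConvergesTo.simpleCoeff h s a).mul (ConvergesTo.sum fun b hb =>
        (ConvergesTo.simpleCoeff h D b).mul (h a b (Finset.ne_of_mem_erase hb).symm))
    · exact ConvergesTo.zero z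
  exact (key s D _).add (key D s _)

/-- The factor `ratio a 0` of the coefficient vanishes at `z = 0`. -/
theorem constantCoeff_simpleCoeff (h0 : 0 ∈ s) (ha : 0 < a) :
    PowerSeries.constantCoeff (simpleCoeff ratio s a) = 0 := by
  rw [simpleCoeff, map_prod]
  exact Finset.prod_eq_zero (Finset.mem_erase.2 ⟨ha.ne, h0⟩) (constantCoeff_ratio_of_lt ha)

theorem constantCoeff_sqCoeff (h0 : 0 ∈ s) (ha : 0 < a) :
    PowerSeries.constantCoeff (sqCoeff ratio s D a) = 0 := by
  rw [sqCoeff, map_mul, constantCoeff_simpleCoeff h0 ha, zero_mul]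

theorem constantCoeff_fracCoeff (h0 : 0 ∈ s) (ha : 0 < a) :
    PowerSeries.constantCoeff (fracCoeff ratio s D a) = 0 := by
  have h1 : PowerSeries.constantCoeff
      (∑ b ∈ s.erase a, simpleCoeff ratio s b * ratio a b) = 0 := by
    rw [map_sum]
    refine Finset.sum_eq_zero fun b _ => ?_
    rw [map_mul]
    rcases Nat.eq_zero_or_pos b with rfl | hb
    · rw [constantCoeff_ratio_of_lt ha, mul_zero]
    · rw [constantCoeff_simpleCoeff h0 hb, zero_mul]
  rw [fracCoeff, map_add, apply_ite PowerSeries.constantCoeff, map_mul,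
    constantCoeff_simpleCoeff h0 ha, apply_ite PowerSeries.constantCoeff, map_mul, h1]
  simp

end Coefficients

/-! ### The partial fraction decomposition of `f(t z^{d₂}, z)` -/

theorem one_sub_mul_geom (a : ℕ) : (1 - t * incl (z ^ a)) * geom a = 1 :=
  PowerSeries.mul_invOfUnit _ _ (by simp [t])

theorem geom_eq_mk (a : ℕ) : geom a = PowerSeries.mk fun n => z ^ (a * n) := by
  have h : (1 - t * incl (z ^ a)) * PowerSeries.mk (fun n => z ^ (a * n)) = 1 := by
    ext1 n
    rw [sub_mul, one_mul, map_sub, mul_assoc, t]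
    rcases n with _ | n
    · simp
    · rw [PowerSeries.coeff_succ_X_mul, incl, PowerSeries.coeff_C_mul]
      simp only [PowerSeries.coeff_mk, PowerSeries.coeff_one]
      rw [if_neg (Nat.succ_ne_zero n), ← pow_add, sub_eq_zero]
      congr 1
      ring
  calc geom a = geom a * ((1 - t * incl (z ^ a)) * PowerSeries.mk fun n => z ^ (a * n)) := by
        rw [h, mul_one]
    _ = ((1 - t * incl (z ^ a)) * geom a) * PowerSeries.mk fun n => z ^ (a * n) := by ring
    _ = _ := by rw [one_sub_mul_geom, one_mul]

theorem coeff_geom (a n : ℕ) : PowerSeries.coeff n (geom a) = z ^ (a * n) := by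
  rw [geom_eq_mk, PowerSeries.coeff_mk]

theorem coeff_geom_sq (a n : ℕ) :
    PowerSeries.coeff n (geom a ^ 2) = ((n : ℂ⟦X⟧) + 1) * z ^ (a * n) := by
  have h : ∀ p ∈ Finset.HasAntidiagonal.antidiagonal n,
      PowerSeries.coeff p.1 (geom a) * PowerSeries.coeff p.2 (geom a) = z ^ (a * n) := by
    intro p hp
    rw [coeff_geom, coeff_geom, ← pow_add, ← mul_add,
      Finset.HasAntidiagonal.mem_antidiagonal.1 hp]
  rw [sq, PowerSeries.coeff_mul, Finset.sum_congr rfl h, Finset.sum_const,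
    Finset.Nat.card_antidiagonal, nsmul_eq_mul]
  push_cast
  rfl

@[to_additive]
theorem prod_range_reflect_Icc {M : Type*} [CommMonoid M] (h : ℕ → M) (d e : ℕ) :
    ∏ i ∈ Finset.range (d + 1), h (e + d - i) = ∏ a ∈ Finset.Icc e (e + d), h a := by
  refine Finset.prod_nbij' (fun i => e + d - i) (fun a => e + d - a) ?_ ?_ ?_ ?_ ?_ <;>
    intro a ha <;> simp only [Finset.mem_range, Finset.mem_Icc] at ha ⊢ <;> omega

section Decomposition

variable (d e : ℕ)

theorem Icc_subset_range : Finset.Icc e (e + d) ⊆ Finset.range (d + 2 * e + 1) := by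
  intro a
  simp only [Finset.mem_Icc, Finset.mem_range]
  omega

theorem fSeries_eq_prod : fSeries d (d + 2 * e) =
    (∏ a ∈ Finset.range (d + 2 * e + 1), geom (2 * a)) *
      ∏ a ∈ Finset.Icc e (e + d), geom (2 * a) := by
  rw [fSeries, mul_comm, ← prod_range_reflect_Icc,
    ← Finset.prod_range_reflect (fun a => geom (2 * a))]
  congr 1 <;>
  · refine Finset.prod_congr rfl fun i hi => congrArg geom ?_
    have := Finset.mem_range.1 hi
    omega

theorem pow_two_mul_z_injective : Function.Injective fun a : ℕ => (z : ℂ⟦X⟧) ^ (2 * a) := by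
  intro a b h
  have := congrArg PowerSeries.order h
  simp only [z, PowerSeries.order_X_pow] at this
  have := Nat.cast_injective this
  omega

theorem fSeries_eq_sum : fSeries d (d + 2 * e) =
    ∑ a ∈ Finset.range (d + 2 * e + 1),
      incl (fracCoeff ratio (Finset.range (d + 2 * e + 1)) (Finset.Icc e (e + d)) a) *
        geom (2 * a) +
    ∑ a ∈ Finset.Icc e (e + d),
      incl (sqCoeff ratio (Finset.range (d + 2 * e + 1)) (Finset.Icc e (e + d)) a) *
        geom (2 * a) ^ 2 := by
  rw [fSeries_eq_prod, partialFractions (fun a => incl (z ^ (2 * a)))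
    (PowerSeries.C_injective.comp pow_two_mul_z_injective) (fun a b => incl (ratio a b)) ?_ _ _
    ⟨e, by simp⟩ (Icc_subset_range d e) t _ fun a _ => one_sub_mul_geom (2 * a)]
  · simp [fracCoeff, sqCoeff, simpleCoeff, apply_ite incl]
  · intro a b h
    rw [← map_sub, ← map_mul, ratio_mul h]

theorem f_eq_prod {z : ℂ} (hz : z ≠ 0) (t : ℂ) : f d (d + 2 * e) (t * z ^ (d + 2 * e)) z =
    (∏ a ∈ Finset.range (d + 2 * e + 1), (1 - t * z ^ (2 * a))⁻¹) *
      ∏ a ∈ Finset.Icc e (e + d), (1 - t * z ^ (2 * a))⁻¹ := by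
  have key : ∀ (m : ℤ) (n : ℕ), ((d + 2 * e : ℕ) : ℤ) + m = n →
      1 - t * z ^ (d + 2 * e) * z ^ m = 1 - t * z ^ n := by
    intro m n h
    rw [← zpow_natCast z n, ← h, zpow_add₀ hz, zpow_natCast]
    ring
  rw [f, one_div, mul_inv, mul_comm, ← prod_range_reflect_Icc,
    ← Finset.prod_range_reflect (fun a => (1 - t * z ^ (2 * a))⁻¹), ← Finset.prod_inv_distrib,
    ← Finset.prod_inv_distrib]
  congr 1 <;>
  · refine Finset.prod_congr rfl fun i hi => congrArg _ (key _ _ ?_)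
    have := Finset.mem_range.1 hi
    omega

/-- The numerical partial fraction decomposition, with the coefficients of
`fSeries_eq_sum` evaluated at `z`. -/
theorem f_eq_sum {z : ℂ} (h0 : 0 < ‖z‖) (h1 : ‖z‖ < 1) (t : ℂ)
    (ht : ∀ a ∈ Finset.range (d + 2 * e + 1), 1 - t * z ^ (2 * a) ≠ 0) :
    f d (d + 2 * e) (t * z ^ (d + 2 * e)) z =
    ∑ a ∈ Finset.range (d + 2 * e + 1),
      (fracCoeff (fun a b => z ^ (2 * a) / (z ^ (2 * a) - z ^ (2 * b)))
        (Finset.range (d + 2 * e + 1)) (Finset.Icc e (e + d)) a * (1 - t * z ^ (2 * a))⁻¹ +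
      (if a ∈ Finset.Icc e (e + d) then
        sqCoeff (fun a b => z ^ (2 * a) / (z ^ (2 * a) - z ^ (2 * b)))
          (Finset.range (d + 2 * e + 1)) (Finset.Icc e (e + d)) a else 0) *
        (1 - t * z ^ (2 * a))⁻¹ ^ 2) := by
  rw [f_eq_prod d e (norm_pos_iff.1 h0), partialFractions (fun a => z ^ (2 * a))
    (pow_two_mul_injective h0 h1) (fun a b => z ^ (2 * a) / (z ^ (2 * a) - z ^ (2 * b))) ?_ _ _
    ⟨e, by simp⟩ (Icc_subset_range d e) t _ fun a ha => mul_inv_cancel₀ (ht a ha)]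
  · rw [Finset.sum_add_distrib]
    simp only [ite_mul, zero_mul]
    rw [← Finset.sum_filter, Finset.filter_mem_eq_inter,
      Finset.inter_eq_right.2 (Icc_subset_range d e)]
  · intro a b h
    exact div_mul_cancel₀ _ (sub_ne_zero.2 ((pow_two_mul_injective h0 h1).ne h))

variable {d e}

theorem zpow_neg_two_mul (z : ℂ) (a : ℕ) : z ^ (-((2 * a : ℕ) : ℤ)) = (z ^ (2 * a))⁻¹ := by
  rw [zpow_neg, zpow_natCast]

theorem isCoeffA_fracCoeff {a : ℕ} (ha : a ∈ Finset.range (d + 2 * e + 1)) :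
    IsCoeffA d (d + 2 * e) (2 * a)
      (fracCoeff ratio (Finset.range (d + 2 * e + 1)) (Finset.Icc e (e + d)) a) := by
  intro z h0 h1
  refine ⟨_, ?_, (ConvergesTo.fracCoeff (fun a b h => convergesTo_ratio h h0 h1) _ _ a).2⟩
  rw [zpow_neg_two_mul]
  have := tendsto_deriv_double_pole (pow_two_mul_injective h0 h1)
    (fun a => pow_ne_zero _ (norm_pos_iff.1 h0)) (f_eq_sum d e h0 h1) ha
  exact this

theorem isCoeffB_sqCoeff {a : ℕ} (ha : a ∈ Finset.Icc e (e + d)) :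
    IsCoeffB d (d + 2 * e) (2 * a)
      (sqCoeff ratio (Finset.range (d + 2 * e + 1)) (Finset.Icc e (e + d)) a) := by
  intro z h0 h1
  refine ⟨_, ?_, (ConvergesTo.sqCoeff (fun a b h => convergesTo_ratio h h0 h1) _ _ a).2⟩
  rw [zpow_neg_two_mul]
  have := tendsto_double_pole (pow_two_mul_injective h0 h1)
    (fun a => pow_ne_zero _ (norm_pos_iff.1 h0)) (f_eq_sum d e h0 h1) (Icc_subset_range d e ha)
  rwa [if_pos ha] at this

theorem isCoeffC_fracCoeff {a : ℕ} (ha : a ∈ Finset.range (d + 2 * e + 1))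
    (ha' : a ∉ Finset.Icc e (e + d)) :
    IsCoeffC d (d + 2 * e) (2 * a)
      (fracCoeff ratio (Finset.range (d + 2 * e + 1)) (Finset.Icc e (e + d)) a) := by
  intro z h0 h1
  refine ⟨_, ?_, (ConvergesTo.fracCoeff (fun a b h => convergesTo_ratio h h0 h1) _ _ a).2⟩
  rw [zpow_neg_two_mul]
  have := tendsto_simple_pole (pow_two_mul_injective h0 h1)
    (fun a => pow_ne_zero _ (norm_pos_iff.1 h0)) (f_eq_sum d e h0 h1) ha (if_neg ha')
  exact this

theorem mem_lowSimple {k : ℕ} : k ∈ lowSimple d (d + 2 * e) ↔ k < e := by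
  rw [lowSimple, Finset.mem_filter, Finset.mem_range]
  push_cast
  omega

theorem mem_highSimple {k : ℕ} :
    k ∈ highSimple d (d + 2 * e) ↔ e + d < k ∧ k < d + 2 * e + 1 := by
  rw [highSimple, Finset.mem_filter, Finset.mem_range]
  omega

/-- The exponents `2 a` with `a ≤ d₂` are those of the double poles, listed downwards, and those of
the two ranges of simple poles. -/
theorem sum_range_eq_sum_poles {M : Type*} [AddCommMonoid M] (h : ℕ → M) :
    ∑ a ∈ Finset.range (d + 2 * e + 1), h a =
      ∑ k ∈ Finset.range (d + 1), h (e + d - k) + ∑ k ∈ lowSimple d (d + 2 * e), h k +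
        ∑ k ∈ highSimple d (d + 2 * e), h k := by
  rw [sum_range_reflect_Icc, ← Finset.sum_union, ← Finset.sum_union]
  · refine Finset.sum_congr (Finset.ext fun a => ?_) fun _ _ => rfl
    simp only [Finset.mem_union, Finset.mem_Icc, mem_lowSimple, mem_highSimple, Finset.mem_range]
    omega
  · rw [Finset.disjoint_left]
    intro a
    simp only [Finset.mem_union, Finset.mem_Icc, mem_lowSimple, mem_highSimple]
    omega
  · rw [Finset.disjoint_left]
    intro a
    simp only [Finset.mem_Icc, mem_lowSimple]
    omega

end Decomposition

/-! ### The operator `Ψ` on partial fractions -/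

theorem coeff_phi_of_nonneg {m : ℤ} (hm : 0 ≤ m) (R : ℂ⟦X⟧) (i : ℕ) :
    PowerSeries.coeff i (phi m R) = PowerSeries.coeff (i * m.toNat) R := by
  rw [phi, if_neg hm.not_gt, PowerSeries.coeff_mk]

/-- The coefficient picked out by `Ψ_{1,n}` in `R / (1 - t z ^ a)`. For `a > n` the operator `φ`
is zero by convention, whereas `Ψ` picks the constant coefficient of `R` at `i = 0`; hence the
hypothesis. -/
theorem coeff_mul_z_pow (n a i : ℕ) (R : ℂ⟦X⟧)
    (h : n < a → PowerSeries.constantCoeff R = 0) :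
    PowerSeries.coeff (i * n) (R * z ^ (a * i)) =
      PowerSeries.coeff i (phi ((n : ℤ) - a) R) := by
  rw [z, PowerSeries.coeff_mul_X_pow']
  rcases Nat.lt_or_ge n a with hlt | hle
  · rw [phi, if_pos (by omega : (n : ℤ) - a < 0), map_zero]
    rcases Nat.eq_zero_or_pos i with rfl | hi
    · simpa using h hlt
    · rw [if_neg]
      rw [mul_comm a, not_le]
      exact Nat.mul_lt_mul_of_pos_left hlt hi
  · rw [coeff_phi_of_nonneg (by omega), if_pos (by rw [mul_comm a]; exact Nat.mul_le_mul_left i hle)]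
    congr 2
    rw [mul_comm a, ← Nat.mul_sub]
    congr 1
    omega

theorem Psi_incl_mul_geom (n a : ℕ) (R : ℂ⟦X⟧)
    (h : n < a → PowerSeries.constantCoeff R = 0) :
    Psi 1 n (incl R * geom a) = phi ((n : ℤ) - a) R := by
  ext i
  simp only [Psi, LinearMap.coe_mk, AddHom.coe_mk, PowerSeries.coeff_mk, mul_one, incl,
    PowerSeries.coeff_C_mul, coeff_geom]
  exact coeff_mul_z_pow n a i R h

theorem Psi_incl_mul_geom_sq (n a : ℕ) (R : ℂ⟦X⟧)
    (h : n < a → PowerSeries.constantCoeff R = 0) :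
    Psi 1 n (incl R * geom a ^ 2) =
      PowerSeries.derivative ℂ (z * phi ((n : ℤ) - a) R) := by
  ext i
  simp only [Psi, LinearMap.coe_mk, AddHom.coe_mk, PowerSeries.coeff_mk, mul_one, incl,
    PowerSeries.coeff_C_mul, coeff_geom_sq]
  rw [PowerSeries.coeff_derivative, z, PowerSeries.coeff_succ_X_mul, ← coeff_mul_z_pow n a i R h,
    mul_left_comm, ← Nat.cast_succ, ← nsmul_eq_mul, map_nsmul, nsmul_eq_mul, mul_comm]
  push_cast
  rfl

theorem phi_of_neg {m : ℤ} (hm : m < 0) (R : ℂ⟦X⟧) : phi m R = 0 := if_pos hm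

/-! ### The action of `sl₂` on `S(V_{d₁} ⊕ V_{d₂})` -/

/-- A derivation of a polynomial ring that is diagonal on the variables is diagonal on the
monomials. -/
theorem coeff_mkDerivation_smul_X {σ : Type*} [Fintype σ] (c : σ → ℂ) (p : MvPolynomial σ ℂ)
    (l : σ →₀ ℕ) :
    MvPolynomial.coeff l (MvPolynomial.mkDerivation ℂ (fun s => c s • MvPolynomial.X s) p) =
      (∑ s, (l s : ℂ) * c s) * MvPolynomial.coeff l p := by
  classical
  induction p using MvPolynomial.induction_on' with
  | add p q hp hq => rw [map_add, MvPolynomial.coeff_add, hp, hq, MvPolynomial.coeff_add, mul_add]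
  | monomial m a =>
    have h : (m.sum fun i k => MvPolynomial.monomial (m - Finsupp.single i 1) (k : ℂ) •
        (c i • (MvPolynomial.X i : MvPolynomial σ ℂ))) =
        MvPolynomial.monomial m (∑ s, (m s : ℂ) * c s) := by
      rw [Finsupp.sum_fintype _ _ (by simp), map_sum]
      refine Finset.sum_congr rfl fun i _ => ?_
      rcases Nat.eq_zero_or_pos (m i) with h | h
      · simp [h]
      · rw [MvPolynomial.X, MvPolynomial.smul_monomial, smul_eq_mul, MvPolynomial.monomial_mul,
          tsub_add_cancel_of_le (Finsupp.single_le_iff.2 h)]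
        simp
    rw [MvPolynomial.mkDerivation_monomial, h, MvPolynomial.coeff_smul,
      MvPolynomial.coeff_monomial, MvPolynomial.coeff_monomial, smul_eq_mul]
    split_ifs with hm
    · rw [hm, mul_comm]
    · simp

section Sl2

variable (d₁ d₂ : ℕ)

/-- The weights of the basis vectors: `vᵢ` has weight `d₁ - 2i` and `wⱼ` has weight `d₂ - 2j`. -/
def weight : Idx d₁ d₂ → ℤ :=
  Sum.elim (fun i => (d₁ : ℤ) - 2 * (i : ℕ)) (fun j => (d₂ : ℤ) - 2 * (j : ℕ))

/-- The action of the semisimple element `[D₁, D₂]` of `sl₂`. -/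
def H : Derivation ℂ (Sym d₁ d₂) (Sym d₁ d₂) :=
  MvPolynomial.mkDerivation ℂ fun s => (weight d₁ d₂ s : ℂ) • MvPolynomial.X s

/-- The Euler derivation, which multiplies a form of degree `n` by `n`. -/
def euler : Derivation ℂ (Sym d₁ d₂) (Sym d₁ d₂) :=
  MvPolynomial.mkDerivation ℂ fun s => (1 : ℂ) • MvPolynomial.X s

variable {d₁ d₂}

theorem D1_v {i : ℕ} (hi : i ≤ d₁) : D1 d₁ d₂ (v d₁ d₂ i) = (i : ℂ) • v d₁ d₂ (i - 1) := by
  rw [v, dif_pos (by omega), D1, MvPolynomial.mkDerivation_X, Sum.elim_inl]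

theorem D1_w {i : ℕ} (hi : i ≤ d₂) : D1 d₁ d₂ (w d₁ d₂ i) = (i : ℂ) • w d₁ d₂ (i - 1) := by
  rw [w, dif_pos (by omega), D1, MvPolynomial.mkDerivation_X, Sum.elim_inr]

theorem D2_v {i : ℕ} (hi : i ≤ d₁) :
    D2 d₁ d₂ (v d₁ d₂ i) = ((d₁ : ℂ) - i) • v d₁ d₂ (i + 1) := by
  rw [v, dif_pos (by omega), D2, MvPolynomial.mkDerivation_X, Sum.elim_inl]

theorem D2_w {i : ℕ} (hi : i ≤ d₂) :
    D2 d₁ d₂ (w d₁ d₂ i) = ((d₂ : ℂ) - i) • w d₁ d₂ (i + 1) := by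
  rw [w, dif_pos (by omega), D2, MvPolynomial.mkDerivation_X, Sum.elim_inr]

theorem H_v (i : ℕ) : H d₁ d₂ (v d₁ d₂ i) = ((d₁ : ℂ) - 2 * i) • v d₁ d₂ i := by
  rw [v]
  split_ifs
  · simp [H, weight]
  · simp

theorem H_w (i : ℕ) : H d₁ d₂ (w d₁ d₂ i) = ((d₂ : ℂ) - 2 * i) • w d₁ d₂ i := by
  rw [w]
  split_ifs
  · simp [H, weight]
  · simp

theorem euler_v (i : ℕ) : euler d₁ d₂ (v d₁ d₂ i) = v d₁ d₂ i := by
  rw [v]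
  split_ifs <;> simp [euler]

theorem euler_w (i : ℕ) : euler d₁ d₂ (w d₁ d₂ i) = w d₁ d₂ i := by
  rw [w]
  split_ifs <;> simp [euler]

theorem derivation_ext_basis {A B : Derivation ℂ (Sym d₁ d₂) (Sym d₁ d₂)}
    (hv : ∀ i ≤ d₁, A (v d₁ d₂ i) = B (v d₁ d₂ i))
    (hw : ∀ i ≤ d₂, A (w d₁ d₂ i) = B (w d₁ d₂ i)) : A = B := by
  refine MvPolynomial.derivation_ext fun s => ?_
  rcases s with i | i
  · have := hv i (Nat.lt_succ_iff.1 i.isLt)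
    rw [v, dif_pos i.isLt] at this
    exact this
  · have := hw i (Nat.lt_succ_iff.1 i.isLt)
    rw [w, dif_pos i.isLt] at this
    exact this

theorem lie_D1_D2 : ⁅D1 d₁ d₂, D2 d₁ d₂⁆ = H d₁ d₂ := by
  refine derivation_ext_basis (fun i hi => ?_) fun i hi => ?_
  · rw [Derivation.commutator_apply, D2_v hi, D1_v hi, H_v, Derivation.map_smul,
      Derivation.map_smul, D2_v (by omega)]
    have h1 : ((d₁ : ℂ) - i) • D1 d₁ d₂ (v d₁ d₂ (i + 1)) =
        (((d₁ : ℂ) - i) * (i + 1)) • v d₁ d₂ i := by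
      rcases hi.eq_or_lt with rfl | h
      · simp
      · rw [D1_v h, smul_smul, Nat.succ_sub_one, Nat.cast_succ]
    rw [h1]
    rcases i with _ | i
    · simp
    · rw [Nat.add_sub_cancel, smul_smul, ← sub_smul]
      congr 1
      push_cast
      ring
  · rw [Derivation.commutator_apply, D2_w hi, D1_w hi, H_w, Derivation.map_smul,
      Derivation.map_smul, D2_w (by omega)]
    have h1 : ((d₂ : ℂ) - i) • D1 d₁ d₂ (w d₁ d₂ (i + 1)) =
        (((d₂ : ℂ) - i) * (i + 1)) • w d₁ d₂ i := by
      rcases hi.eq_or_lt with rfl | h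
      · simp
      · rw [D1_w h, smul_smul, Nat.succ_sub_one, Nat.cast_succ]
    rw [h1]
    rcases i with _ | i
    · simp
    · rw [Nat.add_sub_cancel, smul_smul, ← sub_smul]
      congr 1
      push_cast
      ring

theorem lie_H_D1 : ⁅H d₁ d₂, D1 d₁ d₂⁆ = (2 : ℂ) • D1 d₁ d₂ := by
  refine derivation_ext_basis (fun i hi => ?_) fun i hi => ?_
  · rw [Derivation.commutator_apply, Derivation.smul_apply, H_v, Derivation.map_smul, D1_v hi,
      Derivation.map_smul, H_v]
    rcases i with _ | i
    · simp
    · rw [Nat.add_sub_cancel, smul_smul, smul_smul, smul_smul, ← sub_smul]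
      congr 1
      push_cast
      ring
  · rw [Derivation.commutator_apply, Derivation.smul_apply, H_w, Derivation.map_smul, D1_w hi,
      Derivation.map_smul, H_w]
    rcases i with _ | i
    · simp
    · rw [Nat.add_sub_cancel, smul_smul, smul_smul, smul_smul, ← sub_smul]
      congr 1
      push_cast
      ring

theorem lie_H_D2 : ⁅H d₁ d₂, D2 d₁ d₂⁆ = (-2 : ℂ) • D2 d₁ d₂ := by
  refine derivation_ext_basis (fun i hi => ?_) fun i hi => ?_
  · rw [Derivation.commutator_apply, Derivation.smul_apply, H_v, Derivation.map_smul, D2_v hi,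
      Derivation.map_smul, H_v, smul_smul, smul_smul, smul_smul, ← sub_smul]
    congr 1
    push_cast
    ring
  · rw [Derivation.commutator_apply, Derivation.smul_apply, H_w, Derivation.map_smul, D2_w hi,
      Derivation.map_smul, H_w, smul_smul, smul_smul, smul_smul, ← sub_smul]
    congr 1
    push_cast
    ring

theorem lie_euler_D1 : ⁅euler d₁ d₂, D1 d₁ d₂⁆ = 0 := by
  refine derivation_ext_basis (fun i hi => ?_) fun i hi => ?_
  · rw [Derivation.commutator_apply, euler_v, D1_v hi, Derivation.map_smul, euler_v, sub_self,
      Derivation.zero_apply]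
  · rw [Derivation.commutator_apply, euler_w, D1_w hi, Derivation.map_smul, euler_w, sub_self,
      Derivation.zero_apply]

theorem lie_euler_D2 : ⁅euler d₁ d₂, D2 d₁ d₂⁆ = 0 := by
  refine derivation_ext_basis (fun i hi => ?_) fun i hi => ?_
  · rw [Derivation.commutator_apply, euler_v, D2_v hi, Derivation.map_smul, euler_v, sub_self,
      Derivation.zero_apply]
  · rw [Derivation.commutator_apply, euler_w, D2_w hi, Derivation.map_smul, euler_w, sub_self,
      Derivation.zero_apply]

theorem D1_D2_apply (p : Sym d₁ d₂) :
    D1 d₁ d₂ (D2 d₁ d₂ p) = D2 d₁ d₂ (D1 d₁ d₂ p) + H d₁ d₂ p := by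
  rw [← lie_D1_D2, Derivation.commutator_apply]
  abel

/-! ### Weight spaces -/

variable (d₁ d₂)

/-- The exponents of the monomials of degree `n` and weight `m`. -/
def weightExponents (n : ℕ) (m : ℤ) : Finset (Idx d₁ d₂ →₀ ℕ) :=
  (Finset.univ.finsuppAntidiag n).filter fun l => ∑ s, (l s : ℤ) * weight d₁ d₂ s = m

/-- The weight space of weight `m` in the `n`-th symmetric power of `V_{d₁} ⊕ V_{d₂}`, defined as
the span of the monomials of degree `n` and weight `m`. -/
def weightSpace (n : ℕ) (m : ℤ) : Submodule ℂ (Sym d₁ d₂) :=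
  MvPolynomial.restrictSupport ℂ (weightExponents d₁ d₂ n m : Set (Idx d₁ d₂ →₀ ℕ))

instance (n : ℕ) (m : ℤ) : FiniteDimensional ℂ (weightSpace d₁ d₂ n m) :=
  Module.Finite.of_basis (MvPolynomial.basisRestrictSupport ℂ _)

theorem finrank_weightSpace (n : ℕ) (m : ℤ) :
    Module.finrank ℂ (weightSpace d₁ d₂ n m) = (weightExponents d₁ d₂ n m).card := by
  rw [weightSpace, Module.finrank_eq_card_basis (MvPolynomial.basisRestrictSupport ℂ _)]
  simp

variable {d₁ d₂} {n : ℕ} {m : ℤ} {p : Sym d₁ d₂}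

theorem mem_weightExponents {l : Idx d₁ d₂ →₀ ℕ} : l ∈ weightExponents d₁ d₂ n m ↔
    ∑ s, l s = n ∧ ∑ s, (l s : ℤ) * weight d₁ d₂ s = m := by
  simp [weightExponents]

theorem mkDerivation_smul_X_eq_smul_iff (c : Idx d₁ d₂ → ℂ) (μ : ℂ) :
    MvPolynomial.mkDerivation ℂ (fun s => c s • MvPolynomial.X s) p = μ • p ↔
      ∀ l ∈ p.support, ∑ s, (l s : ℂ) * c s = μ := by
  simp only [MvPolynomial.ext_iff, coeff_mkDerivation_smul_X, MvPolynomial.coeff_smul, smul_eq_mul,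
    mul_eq_mul_right_iff, MvPolynomial.mem_support_iff]
  exact forall_congr' fun l => by tauto

theorem euler_apply_eq_iff :
    euler d₁ d₂ p = (n : ℂ) • p ↔ ∀ l ∈ p.support, ∑ s, l s = n := by
  rw [euler, mkDerivation_smul_X_eq_smul_iff]
  refine forall₂_congr fun l _ => ?_
  simp only [mul_one]
  exact_mod_cast Iff.rfl

theorem mem_weightSpace_iff :
    p ∈ weightSpace d₁ d₂ n m ↔ euler d₁ d₂ p = (n : ℂ) • p ∧ H d₁ d₂ p = (m : ℂ) • p := by
  rw [euler_apply_eq_iff, H, mkDerivation_smul_X_eq_smul_iff, weightSpace,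
    MvPolynomial.mem_restrictSupport_iff]
  simp only [Set.subset_def, SetLike.mem_coe, mem_weightExponents]
  rw [← forall₂_and]
  refine forall₂_congr fun l _ => and_congr Iff.rfl ?_
  exact_mod_cast Iff.rfl

theorem D1_mem_weightSpace (hp : p ∈ weightSpace d₁ d₂ n m) :
    D1 d₁ d₂ p ∈ weightSpace d₁ d₂ n (m + 2) := by
  rw [mem_weightSpace_iff] at hp ⊢
  have h1 := congrArg (fun δ => δ p) (lie_euler_D1 (d₁ := d₁) (d₂ := d₂))
  have h2 := congrArg (fun δ => δ p) (lie_H_D1 (d₁ := d₁) (d₂ := d₂))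
  simp only [Derivation.commutator_apply, Derivation.zero_apply, Derivation.smul_apply, hp.1, hp.2,
    Derivation.map_smul] at h1 h2
  refine ⟨sub_eq_zero.1 h1, ?_⟩
  rw [sub_eq_iff_eq_add.1 h2, ← add_smul]
  push_cast
  rw [add_comm]

theorem D2_mem_weightSpace (hp : p ∈ weightSpace d₁ d₂ n m) :
    D2 d₁ d₂ p ∈ weightSpace d₁ d₂ n (m - 2) := by
  rw [mem_weightSpace_iff] at hp ⊢
  have h1 := congrArg (fun δ => δ p) (lie_euler_D2 (d₁ := d₁) (d₂ := d₂))
  have h2 := congrArg (fun δ => δ p) (lie_H_D2 (d₁ := d₁) (d₂ := d₂))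
  simp only [Derivation.commutator_apply, Derivation.zero_apply, Derivation.smul_apply, hp.1, hp.2,
    Derivation.map_smul] at h1 h2
  refine ⟨sub_eq_zero.1 h1, ?_⟩
  rw [sub_eq_iff_eq_add.1 h2, ← add_smul]
  push_cast
  congr 1
  ring

theorem D1_iterate_mem_weightSpace (hp : p ∈ weightSpace d₁ d₂ n m) (k : ℕ) :
    (D1 d₁ d₂)^[k] p ∈ weightSpace d₁ d₂ n (m + 2 * k) := by
  induction k with
  | zero => simpa using hp
  | succ k ih =>
    rw [Function.iterate_succ_apply']
    have h : m + 2 * ((k + 1 : ℕ) : ℤ) = m + 2 * k + 2 := by push_cast; ring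
    rw [h]
    exact D1_mem_weightSpace ih

theorem D2_iterate_mem_weightSpace (hp : p ∈ weightSpace d₁ d₂ n m) (k : ℕ) :
    (D2 d₁ d₂)^[k] p ∈ weightSpace d₁ d₂ n (m - 2 * k) := by
  induction k with
  | zero => simpa using hp
  | succ k ih =>
    rw [Function.iterate_succ_apply']
    have h : m - 2 * ((k + 1 : ℕ) : ℤ) = m - 2 * k - 2 := by push_cast; ring
    rw [h]
    exact D2_mem_weightSpace ih

theorem abs_weight_le (s : Idx d₁ d₂) : |weight d₁ d₂ s| ≤ d₁ + d₂ := by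
  rcases s with i | i <;>
  · have := i.isLt
    simp only [weight, Sum.elim_inl, Sum.elim_inr, abs_le]
    omega

theorem eq_zero_of_mem_weightSpace (hp : p ∈ weightSpace d₁ d₂ n m)
    (hm : (n : ℤ) * (d₁ + d₂) < |m|) : p = 0 := by
  by_contra h
  obtain ⟨l, hl⟩ := MvPolynomial.support_nonempty.2 h
  rw [weightSpace, MvPolynomial.mem_restrictSupport_iff] at hp
  obtain ⟨h1, h2⟩ := mem_weightExponents.1 (hp hl)
  refine hm.not_ge ?_
  rw [← h2, ← h1, Nat.cast_sum, Finset.sum_mul]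
  refine (Finset.abs_sum_le_sum_abs _ _).trans (Finset.sum_le_sum fun s _ => ?_)
  rw [abs_mul, Nat.abs_cast]
  exact mul_le_mul_of_nonneg_left (abs_weight_le s) (Nat.cast_nonneg _)

/-- The relation `E Fᵏ⁺¹ x = -(k + 1) (k + 2) Fᵏ x`, for `x` of weight `-2` with `F E x = 0`, shows
that `Fᵏ⁺¹ x = 0` implies `Fᵏ x = 0`. -/
theorem eq_zero_of_weight_neg_two {M : Type*} [AddCommGroup M] [Module ℂ M] (E F h : M →ₗ[ℂ] M)
    (hEF : ∀ x, E (F x) = F (E x) + h x) (x : M)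
    (hh : ∀ k : ℕ, h (F^[k] x) = (-2 - 2 * k : ℂ) • F^[k] x) (hFE : F (E x) = 0)
    (N : ℕ) (hN : F^[N] x = 0) : x = 0 := by
  have key : ∀ k : ℕ, E (F^[k + 1] x) = (-((k + 1) * (k + 2)) : ℂ) • F^[k] x := by
    intro k
    induction k with
    | zero =>
      have := hh 0
      simp only [Function.iterate_zero, id_eq, Function.iterate_succ, Function.comp_apply] at this ⊢
      rw [hEF, hFE, this, zero_add]
      congr 1
      push_cast
      ring
    | succ k ih =>
      rw [Function.iterate_succ_apply', hEF, ih, map_smul, ← Function.iterate_succ_apply' F, hh,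
        ← add_smul]
      congr 1
      push_cast
      ring
  induction N with
  | zero => exact hN
  | succ N ih =>
    apply ih
    have h1 := key N
    rw [hN, map_zero] at h1
    refine (smul_eq_zero.1 h1.symm).resolve_left ?_
    rw [neg_eq_zero]
    exact_mod_cast (by positivity : (N + 1) * (N + 2) ≠ 0)

theorem eq_zero_of_D2_D1_eq_zero (hp : p ∈ weightSpace d₁ d₂ n (-2))
    (h : D2 d₁ d₂ (D1 d₁ d₂ p) = 0) : p = 0 := by
  refine eq_zero_of_weight_neg_two (D1 d₁ d₂ : Sym d₁ d₂ →ₗ[ℂ] Sym d₁ d₂) (D2 d₁ d₂) (H d₁ d₂)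
    D1_D2_apply p (fun k => ?_) h (n * (d₁ + d₂)) ?_
  · have := (mem_weightSpace_iff.1 (D2_iterate_mem_weightSpace hp k)).2
    push_cast at this
    exact this
  · refine eq_zero_of_mem_weightSpace (D2_iterate_mem_weightSpace hp _) ?_
    rw [abs_of_neg (by push_cast; nlinarith [Int.natCast_nonneg n, Int.natCast_nonneg d₁])]
    push_cast
    nlinarith [mul_nonneg (Int.natCast_nonneg n) (add_nonneg (Int.natCast_nonneg d₁) (Int.natCast_nonneg d₂))]

theorem D1_eq_zero_of_D2_eq_zero (hp : p ∈ weightSpace d₁ d₂ n 0) (h : D2 d₁ d₂ p = 0) :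
    D1 d₁ d₂ p = 0 := by
  have hq := D1_mem_weightSpace hp
  have h2 : D2 d₁ d₂ (D1 d₁ d₂ p) = 0 := by
    have := D1_D2_apply p
    rw [h, map_zero, (mem_weightSpace_iff.1 hp).2] at this
    simpa using this.symm
  -- `D₁ p` has weight `-2` for the opposite triple `(D₂, D₁, -H)`.
  refine eq_zero_of_weight_neg_two (D2 d₁ d₂ : Sym d₁ d₂ →ₗ[ℂ] Sym d₁ d₂) (D1 d₁ d₂)
    (-(H d₁ d₂ : Sym d₁ d₂ →ₗ[ℂ] Sym d₁ d₂)) (fun x => ?_) (D1 d₁ d₂ p) (fun k => ?_) ?_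
    (n * (d₁ + d₂)) ?_
  · have := D1_D2_apply x
    simp only [Derivation.coeFn_coe, LinearMap.neg_apply]
    rw [this]
    abel
  · have := (mem_weightSpace_iff.1 (D1_iterate_mem_weightSpace hq k)).2
    simp only [Derivation.coeFn_coe, LinearMap.neg_apply]
    rw [this, ← neg_smul]
    congr 1
    push_cast
    ring
  · simp [h2]
  · refine eq_zero_of_mem_weightSpace (D1_iterate_mem_weightSpace hq _) ?_
    have := mul_nonneg (Int.natCast_nonneg n)
      (add_nonneg (Int.natCast_nonneg d₁) (Int.natCast_nonneg d₂))
    push_cast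
    rw [abs_of_pos (by linarith)]
    linarith

/-- If `F E` is injective on `W`, then `F` maps `V` onto `W`. -/
theorem finrank_add_finrank_of_injective_comp {M : Type*} [AddCommGroup M] [Module ℂ M]
    {V W J : Submodule ℂ M} [FiniteDimensional ℂ V] [FiniteDimensional ℂ W] (E F : M →ₗ[ℂ] M)
    (hE : ∀ x ∈ W, E x ∈ V) (hF : ∀ x ∈ V, F x ∈ W) (hinj : ∀ x ∈ W, F (E x) = 0 → x = 0)
    (hJ : ∀ x, x ∈ J ↔ x ∈ V ∧ F x = 0) :
    Module.finrank ℂ J + Module.finrank ℂ W = Module.finrank ℂ V := by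
  have hcomp : Function.Injective (F.restrict hF ∘ₗ E.restrict hE) := by
    rw [injective_iff_map_eq_zero]
    intro x hx
    exact Subtype.ext (hinj x x.2 (congrArg Subtype.val hx))
  have hsurj : Function.Surjective (F.restrict hF) :=
    Function.Surjective.of_comp (LinearMap.injective_iff_surjective.1 hcomp)
  have hker : (LinearMap.ker (F.restrict hF)).map V.subtype = J := by
    ext x
    rw [hJ, Submodule.mem_map]
    constructor
    · rintro ⟨y, hy, rfl⟩
      exact ⟨y.2, congrArg Subtype.val hy⟩
    · rintro ⟨h1, h2⟩
      exact ⟨⟨x, h1⟩, Subtype.ext h2, rfl⟩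
  rw [← hker, Submodule.finrank_map_subtype_eq,
    ← LinearMap.finrank_range_add_finrank_ker (F.restrict hF), LinearMap.range_eq_top.2 hsurj,
    finrank_top, add_comm]

theorem mem_jointInvariantsDeg_iff :
    p ∈ jointInvariantsDeg d₁ d₂ n ↔ p ∈ weightSpace d₁ d₂ n 0 ∧ D2 d₁ d₂ p = 0 := by
  have hhom : p ∈ MvPolynomial.homogeneousSubmodule (Idx d₁ d₂) ℂ n ↔
      euler d₁ d₂ p = (n : ℂ) • p := by
    rw [euler_apply_eq_iff, MvPolynomial.mem_homogeneousSubmodule, MvPolynomial.IsHomogeneous,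
      MvPolynomial.IsWeightedHomogeneous]
    refine forall_congr' fun l => ?_
    rw [MvPolynomial.mem_support_iff, Finsupp.weight_apply,
      Finsupp.sum_fintype _ _ (by simp)]
    simp
  have hinv : p ∈ Subalgebra.toSubmodule (jointInvariants d₁ d₂) ↔
      D1 d₁ d₂ p = 0 ∧ D2 d₁ d₂ p = 0 := Iff.rfl
  rw [jointInvariantsDeg, Submodule.mem_inf, hhom, hinv]
  constructor
  · rintro ⟨⟨h1, h2⟩, h3⟩
    refine ⟨mem_weightSpace_iff.2 ⟨h3, ?_⟩, h2⟩
    have := D1_D2_apply p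
    rw [h1, h2, map_zero, map_zero, zero_add] at this
    rw [← this, Int.cast_zero, zero_smul]
  · rintro ⟨h1, h2⟩
    exact ⟨⟨D1_eq_zero_of_D2_eq_zero h1 h2, h2⟩, (mem_weightSpace_iff.1 h1).1⟩

variable (d₁ d₂ n)

/-- `D₂` maps the weight space `0` onto the weight space `-2`, since `D₂ D₁` is injective on the
latter; its kernel consists of the invariants. -/
theorem finrank_jointInvariantsDeg_add :
    Module.finrank ℂ (jointInvariantsDeg d₁ d₂ n) + (weightExponents d₁ d₂ n (-2)).card =
      (weightExponents d₁ d₂ n 0).card := by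
  rw [← finrank_weightSpace, ← finrank_weightSpace]
  refine finrank_add_finrank_of_injective_comp (D1 d₁ d₂ : Sym d₁ d₂ →ₗ[ℂ] Sym d₁ d₂)
    (D2 d₁ d₂ : Sym d₁ d₂ →ₗ[ℂ] Sym d₁ d₂) (fun p hp => ?_) (fun p hp => ?_)
    (fun p hp h => eq_zero_of_D2_D1_eq_zero hp h) fun p => mem_jointInvariantsDeg_iff
  · rw [← neg_add_cancel (2 : ℤ)]
    exact D1_mem_weightSpace hp
  · rw [← zero_sub (2 : ℤ)]
    exact D2_mem_weightSpace hp

end Sl2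

/-! ### The generating function of the weight multiplicities -/

section Counting

variable {d₁ d₂ : ℕ}

theorem coeff_fSeries (n : ℕ) : PowerSeries.coeff n (fSeries d₁ d₂) =
    ∑ l ∈ Finset.univ.finsuppAntidiag n, z ^ (∑ s : Idx d₁ d₂,
      Sum.elim (fun i : Fin (d₁ + 1) => d₂ + d₁ - 2 * (i : ℕ))
        (fun j : Fin (d₂ + 1) => d₂ + d₂ - 2 * (j : ℕ)) s * l s) := by
  have h : fSeries d₁ d₂ = ∏ s : Idx d₁ d₂, geom
      (Sum.elim (fun i : Fin (d₁ + 1) => d₂ + d₁ - 2 * (i : ℕ))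
        (fun j : Fin (d₂ + 1) => d₂ + d₂ - 2 * (j : ℕ)) s) := by
    rw [Fintype.prod_sum_type, fSeries, Finset.prod_range, Finset.prod_range]
    rfl
  rw [h, PowerSeries.coeff_prod]
  simp only [coeff_geom, Finset.prod_pow_eq_pow_sum]

/-- After the shift `t ↦ t z^{d₂}`, the exponent `n d₂` of `z` in the coefficient of `tⁿ` stands
for weight zero, and multiplication by `z ^ r` selects weight `-r`. -/
theorem coeff_z_pow_mul_coeff_fSeries (h : d₁ ≤ d₂) (n r : ℕ) :
    PowerSeries.coeff (n * d₂) (z ^ r * PowerSeries.coeff n (fSeries d₁ d₂)) =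
      ((weightExponents d₁ d₂ n (-r)).card : ℂ) := by
  rw [coeff_fSeries, Finset.mul_sum, map_sum, weightExponents, Finset.card_filter, Nat.cast_sum]
  refine Finset.sum_congr rfl fun l hl => ?_
  rw [← pow_add, z, PowerSeries.coeff_X_pow, Nat.cast_ite, Nat.cast_one, Nat.cast_zero]
  refine if_congr ?_ rfl rfl
  have hl' : ∑ s, l s = n := (Finset.mem_finsuppAntidiag.1 hl).1
  have key : ((∑ s : Idx d₁ d₂, Sum.elim (fun i : Fin (d₁ + 1) => d₂ + d₁ - 2 * (i : ℕ))
      (fun j : Fin (d₂ + 1) => d₂ + d₂ - 2 * (j : ℕ)) s * l s : ℕ) : ℤ) =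
      ∑ s, (l s : ℤ) * weight d₁ d₂ s + ((n * d₂ : ℕ) : ℤ) := by
    rw [← hl', Finset.sum_mul, Nat.cast_sum, Nat.cast_sum, ← Finset.sum_add_distrib]
    refine Finset.sum_congr rfl fun s _ => ?_
    rw [Nat.cast_mul, Nat.cast_mul, mul_comm, ← mul_add]
    congr 1
    rcases s with i | i <;>
    · have := i.isLt
      simp only [weight, Sum.elim_inl, Sum.elim_inr]
      omega
  rw [← Nat.cast_inj (R := ℤ), Nat.cast_add, key]
  constructor <;> intro h <;> linarith

theorem PI_eq_Psi (h : d₁ ≤ d₂) : PI d₁ d₂ = Psi 1 d₂ (incl (1 - z ^ 2) * fSeries d₁ d₂) := by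
  ext n
  simp only [PI, Psi, LinearMap.coe_mk, AddHom.coe_mk, PowerSeries.coeff_mk, mul_one, incl,
    PowerSeries.coeff_C_mul]
  have h0 := coeff_z_pow_mul_coeff_fSeries h n 0
  have h2 := coeff_z_pow_mul_coeff_fSeries h n 2
  rw [pow_zero, one_mul] at h0
  rw [sub_mul, one_mul, map_sub, h0, h2, eq_sub_iff_add_eq]
  exact_mod_cast finrank_jointInvariantsDeg_add d₁ d₂ n

end Counting

end JointForms

end

/-! ### The decomposition and the formula for the Poincaré series -/

theorem theorem4 (d₁ d₂ : ℕ) (hlt : d₁ < d₂) (hpar : d₂ ≡ d₁ [MOD 2]) :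
    PI d₁ d₂ = Psi 1 d₂ (incl (1 - z ^ 2) * fSeries d₁ d₂) ∧
    ∃ A B C : ℕ → ℂ⟦X⟧,
      -- the limits exist, and the series are the expansions of their values
      (∀ k ≤ d₁, IsCoeffA d₁ d₂ (d₂ + d₁ - 2 * k) (A k) ∧
        IsCoeffB d₁ d₂ (d₂ + d₁ - 2 * k) (B k)) ∧
      (∀ k ∈ lowSimple d₁ d₂ ∪ highSimple d₁ d₂, IsCoeffC d₁ d₂ (2 * k) (C k)) ∧
      -- they are the coefficients of the partial fraction decomposition in `t`
      fSeries d₁ d₂ =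
        (∑ k ∈ Finset.range (d₁ + 1),
          (incl (A k) * geom (d₂ + d₁ - 2 * k) + incl (B k) * geom (d₂ + d₁ - 2 * k) ^ 2)) +
        (∑ k ∈ lowSimple d₁ d₂, incl (C k) * geom (2 * k)) +
        ∑ k ∈ highSimple d₁ d₂, incl (C k) * geom (2 * k) ∧
      -- the formula for the Poincaré series
      PI d₁ d₂ =
        (∑ k ∈ Finset.range (d₁ + 1) with d₁ ≤ 2 * k,
          phi (2 * (k : ℤ) - d₁) ((1 - z ^ 2) * A k)) +
        (∑ k ∈ Finset.range (d₁ + 1) with d₁ ≤ 2 * k,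
          PowerSeries.derivative ℂ (z * phi (2 * (k : ℤ) - d₁) ((1 - z ^ 2) * B k))) +
        (∑ k ∈ lowSimple d₁ d₂, phi ((d₂ : ℤ) - 2 * k) ((1 - z ^ 2) * C k)) +
        ∑ k ∈ highSimple d₁ d₂, phi ((d₂ : ℤ) - 2 * k) ((1 - z ^ 2) * C k) := by
  obtain ⟨e, rfl⟩ : ∃ e, d₂ = d₁ + 2 * e := by
    obtain ⟨e, he⟩ := (Nat.modEq_iff_dvd' hlt.le).1 hpar.symm
    exact ⟨e, by omega⟩
  have hPI := PI_eq_Psi (d₁ := d₁) (d₂ := d₁ + 2 * e) hlt.le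
  refine ⟨hPI, ?_⟩
  set s := Finset.range (d₁ + 2 * e + 1) with hs
  set D := Finset.Icc e (e + d₁) with hD
  have hexp : ∀ k ≤ d₁, d₁ + 2 * e + d₁ - 2 * k = 2 * (e + d₁ - k) := by omega
  have hmem : ∀ k ≤ d₁, e + d₁ - k ∈ D := by
    intro k hk
    rw [hD, Finset.mem_Icc]
    omega
  have hsum : fSeries d₁ (d₁ + 2 * e) =
      (∑ k ∈ Finset.range (d₁ + 1),
        (incl (fracCoeff ratio s D (e + d₁ - k)) * geom (d₁ + 2 * e + d₁ - 2 * k) +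
          incl (sqCoeff ratio s D (e + d₁ - k)) * geom (d₁ + 2 * e + d₁ - 2 * k) ^ 2)) +
      (∑ k ∈ lowSimple d₁ (d₁ + 2 * e), incl (fracCoeff ratio s D k) * geom (2 * k)) +
      ∑ k ∈ highSimple d₁ (d₁ + 2 * e), incl (fracCoeff ratio s D k) * geom (2 * k) := by
    have h1 : ∑ k ∈ Finset.range (d₁ + 1),
        (incl (fracCoeff ratio s D (e + d₁ - k)) * geom (d₁ + 2 * e + d₁ - 2 * k) +
          incl (sqCoeff ratio s D (e + d₁ - k)) * geom (d₁ + 2 * e + d₁ - 2 * k) ^ 2) =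
        ∑ k ∈ Finset.range (d₁ + 1),
          incl (fracCoeff ratio s D (e + d₁ - k)) * geom (2 * (e + d₁ - k)) +
        ∑ k ∈ Finset.range (d₁ + 1),
          incl (sqCoeff ratio s D (e + d₁ - k)) * geom (2 * (e + d₁ - k)) ^ 2 := by
      rw [← Finset.sum_add_distrib]
      refine Finset.sum_congr rfl fun k hk => ?_
      rw [hexp k (Nat.lt_succ_iff.1 (Finset.mem_range.1 hk))]
    rw [h1, fSeries_eq_sum, ← hs, ← hD, hs, sum_range_eq_sum_poles, ← hs,
      sum_range_reflect_Icc (fun a => incl (sqCoeff ratio s D a) * geom (2 * a) ^ 2), ← hD]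
    abel
  refine ⟨fun k => fracCoeff ratio s D (e + d₁ - k), fun k => sqCoeff ratio s D (e + d₁ - k),
    fracCoeff ratio s D, fun k hk => ?_, fun k hk => ?_, hsum, ?_⟩
  · rw [hexp k hk]
    exact ⟨isCoeffA_fracCoeff (Icc_subset_range d₁ e (hmem k hk)), isCoeffB_sqCoeff (hmem k hk)⟩
  · rw [Finset.mem_union, mem_lowSimple, mem_highSimple] at hk
    refine isCoeffC_fracCoeff ?_ ?_
    · rw [Finset.mem_range]
      omega
    · rw [Finset.mem_Icc]
      omega
  · -- Beyond `d₂` the coefficients vanish at `z = 0`, so that `Ψ` and `φ` agree there.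
    have h0 : 0 ∈ s := Finset.mem_range.2 (by omega)
    have hA : ∀ a, d₁ + 2 * e < 2 * a →
        PowerSeries.constantCoeff ((1 - z ^ 2) * fracCoeff ratio s D a) = 0 := fun a ha => by
      rw [map_mul, constantCoeff_fracCoeff h0 (by omega), mul_zero]
    have hB : ∀ a, d₁ + 2 * e < 2 * a →
        PowerSeries.constantCoeff ((1 - z ^ 2) * sqCoeff ratio s D a) = 0 := fun a ha => by
      rw [map_mul, constantCoeff_sqCoeff h0 (by omega), mul_zero]
    have hdouble : ∑ k ∈ Finset.range (d₁ + 1), Psi 1 (d₁ + 2 * e) (incl (1 - z ^ 2) *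
          (incl (fracCoeff ratio s D (e + d₁ - k)) * geom (d₁ + 2 * e + d₁ - 2 * k) +
          incl (sqCoeff ratio s D (e + d₁ - k)) * geom (d₁ + 2 * e + d₁ - 2 * k) ^ 2)) =
        ∑ k ∈ Finset.range (d₁ + 1) with d₁ ≤ 2 * k,
          phi (2 * (k : ℤ) - d₁) ((1 - z ^ 2) * fracCoeff ratio s D (e + d₁ - k)) +
        ∑ k ∈ Finset.range (d₁ + 1) with d₁ ≤ 2 * k, PowerSeries.derivative ℂ
          (z * phi (2 * (k : ℤ) - d₁) ((1 - z ^ 2) * sqCoeff ratio s D (e + d₁ - k))) := by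
      rw [Finset.sum_filter, Finset.sum_filter, ← Finset.sum_add_distrib]
      refine Finset.sum_congr rfl fun k hk => ?_
      have hk' : k ≤ d₁ := Nat.lt_succ_iff.1 (Finset.mem_range.1 hk)
      have hcast : ((d₁ + 2 * e : ℕ) : ℤ) - (2 * (e + d₁ - k) : ℕ) = 2 * (k : ℤ) - d₁ := by omega
      rw [hexp k hk', mul_add, ← mul_assoc, ← mul_assoc, ← map_mul, ← map_mul, map_add,
        Psi_incl_mul_geom _ _ _ (hA _), Psi_incl_mul_geom_sq _ _ _ (hB _), hcast]
      split_ifs with h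
      · rfl
      · have hneg : 2 * (k : ℤ) - d₁ < 0 := by omega
        rw [phi_of_neg hneg, phi_of_neg hneg, mul_zero, map_zero]
    have hsimple : ∀ k, Psi 1 (d₁ + 2 * e) (incl (1 - z ^ 2) *
        (incl (fracCoeff ratio s D k) * geom (2 * k))) =
        phi (((d₁ + 2 * e : ℕ) : ℤ) - 2 * k) ((1 - z ^ 2) * fracCoeff ratio s D k) := by
      intro k
      rw [← mul_assoc, ← map_mul, Psi_incl_mul_geom _ _ _ (hA k), Nat.cast_mul, Nat.cast_ofNat]
    rw [hPI, hsum, mul_add, mul_add, map_add, map_add, Finset.mul_sum, Finset.mul_sum,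
      Finset.mul_sum, map_sum, map_sum, map_sum, hdouble]
    simp only [hsimple]
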